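/- Let $d,m,n$ be non-negative integers, let $f_1,\dots,f_m,u_1,\dots,u_n,v_1,\dots,v_n\in\mathcal{D}(\mathbb{R}^d)'$ be complex-valued Schwartz distributions on $\mathbb{R}^d$, and let $b_1,\dots,b_m,c_1,\dots,c_m\in GL(d,\mathbb{R})$. Assume that $$\sum_{i=1}^m f_i(b_ix+c_iy)=\sum_{k=1}^n u_k(y)\,v_k(x)\qquad\text{in } \mathcal{D}(\mathbb{R}^d\times\mathbb{R}^d)'.$$ Here $u_k(y)v_k(x)$ denotes the tensor product distribution, $\varphi\mapsto\langle v_k,\ x\mapsto\langle u_k,\varphi(x,\cdot)\rangle\rangle$, and $f_i(b_ix+c_iy)$ denotes the composition of the distribution $f_i(z)\otimes 1(y)$ with the linear automorphism $(x,y)\mapsto(b_ix+c_iy,\,y)$ of $\mathbb{R}^d\times\mathbb{R}^d$, where the composition $T\circ A$ of a distribution $T$ with a linear automorphism $A$ is given by $\langle T\circ A,\varphi\rangle=|\det A|^{-1}\langle T,\varphi\circ A^{-1}\rangle$. If all matrices $b_i^{-1}c_i-b_j^{-1}c_j$ with $i\neq j$ are invertible, then every $f_i$, $i=1,\dots,m$,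 is (the distribution given by) a continuous exponential polynomial, that is, a function of the form $x\mapsto\sum_{j=1}^r p_j(x)\,e^{\langle a_j,x\rangle}$ with $r\ge 0$, polynomials $p_j\in\mathbb{C}[x_1,\dots,x_d]$ and vectors $a_j\in\mathbb{C}^d$, where $\langle a,x\rangle=\sum_{l=1}^d a_l x_l$. -/

import Mathlib

open TopologicalSpace MeasureTheory
open scoped Distributions ContDiff

namespace TestFunction

section Continuity

variable {E E' V V' : Type*} [NormedAddCommGroup E] [NormedSpace ℝ E]
  [NormedAddCommGroup E'] [NormedSpace ℝ E'] [NormedAddCommGroup V] [NormedSpace ℝ V]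
  [NormedAddCommGroup V'] [NormedSpace ℝ V']

/-- A linear map between spaces of test functions is continuous if it maps functions supported in a
fixed compact set to functions supported in a fixed compact set, with bounds on derivatives. -/
theorem continuous_of_bounds (A : 𝓓((⊤ : Opens E), V) →ₗ[ℝ] 𝓓((⊤ : Opens E'), V'))
    (h : ∀ K : Compacts E, ∃ K' : Compacts E',
      (∀ φ : 𝓓((⊤ : Opens E), V), tsupport φ ⊆ K → ∀ x ∉ K', A φ x = 0) ∧
      ∀ i : ℕ, ∃ (s : Finset ℕ) (C : ℝ), 0 ≤ C ∧ ∀ φ : 𝓓((⊤ : Opens E), V),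
        tsupport φ ⊆ K → ∀ B : ℝ, 0 ≤ B →
        (∀ j ∈ s, ∀ z, ‖iteratedFDeriv ℝ j φ z‖ ≤ B) →
        ∀ x, ‖iteratedFDeriv ℝ i (A φ) x‖ ≤ C * B) : Continuous A := by
  rw [TestFunction.continuous_iff_continuous_comp]
  intro K hK
  obtain ⟨K', hsupp, hb⟩ := h K
  let Φ : 𝓓^{⊤}_{K}(E, V) →ₗ[ℝ] 𝓓^{⊤}_{K'}(E', V') :=
    { toFun := fun φ ↦ ⟨A (ofSupportedIn hK φ), (A (ofSupportedIn hK φ)).contDiff,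
        fun x hx ↦ hsupp (ofSupportedIn hK φ) φ.tsupport_subset x hx⟩
      map_add' := fun f g ↦ by
        ext x
        change A (ofSupportedIn hK f + ofSupportedIn hK g) x = _
        rw [map_add]; rfl
      map_smul' := fun c f ↦ by
        ext x
        change A (c • ofSupportedIn hK f) x = _
        rw [map_smul]; rfl }
  have hΦ : Continuous Φ := by
    refine WithSeminorms.continuous_of_isBounded (ContDiffMapSupportedIn.withSeminorms ℝ E V ⊤ K)
      (ContDiffMapSupportedIn.withSeminorms ℝ E' V' ⊤ K') Φ (.of_real fun i ↦ ?_)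
    obtain ⟨s, C, hC, hb⟩ := hb i
    refine ⟨s, C, fun φ ↦ ?_⟩
    have h0 : 0 ≤ (s.sup fun j ↦ ContDiffMapSupportedIn.seminorm ℝ E V ⊤ K j) φ := apply_nonneg _ _
    refine (ContDiffMapSupportedIn.seminorm_top_le_iff ℝ (mul_nonneg hC h0) i (Φ φ)).2 ?_
    intro x _
    refine hb (ofSupportedIn hK φ) φ.tsupport_subset _ h0 (fun j hj z ↦ ?_) x
    exact (ContDiffMapSupportedIn.norm_iteratedFDeriv_apply_le_seminorm_top ℝ).trans
      (Seminorm.le_finset_sup_apply hj)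
  have : (A ∘ ofSupportedIn hK) =
      (ofSupportedIn (Set.subset_univ _ : (K' : Set E') ⊆ (⊤ : Opens E'))) ∘ Φ := rfl
  rw [this]
  exact (continuous_ofSupportedIn _).comp hΦ

/-- `φ ↦ φ ∘ A` for a linear isomorphism `A`. -/
noncomputable def precompEquiv (A : E ≃L[ℝ] E') :
    𝓓((⊤ : Opens E'), V) →L[ℝ] 𝓓((⊤ : Opens E), V) where
  toFun φ := ⟨φ ∘ A, φ.contDiff.comp A.contDiff,
    φ.hasCompactSupport.comp_homeomorph A.toHomeomorph, Set.subset_univ _⟩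
  map_add' _ _ := rfl
  map_smul' _ _ := rfl
  cont := by
    refine continuous_of_bounds (E := E') (E' := E) ⟨⟨fun φ ↦ ⟨φ ∘ A, φ.contDiff.comp A.contDiff,
      φ.hasCompactSupport.comp_homeomorph A.toHomeomorph, Set.subset_univ _⟩,
      fun _ _ ↦ rfl⟩, fun _ _ ↦ rfl⟩ fun K ↦ ?_
    refine ⟨⟨A.symm '' K, K.isCompact.image A.symm.continuous⟩, fun φ hφ x hx ↦ ?_, fun i ↦ ?_⟩
    · refine image_eq_zero_of_notMem_tsupport (f := φ) fun h ↦ hx ⟨A x, hφ h, by simp⟩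
    · refine ⟨{i}, ‖(A : E →L[ℝ] E')‖ ^ i, by positivity, fun φ _ B hB h x ↦ ?_⟩
      change ‖iteratedFDeriv ℝ i (φ ∘ (A : E →L[ℝ] E')) x‖ ≤ _
      rw [ContinuousLinearMap.iteratedFDeriv_comp_right (A : E →L[ℝ] E') φ.contDiff x
        (by exact_mod_cast le_top)]
      refine (ContinuousMultilinearMap.norm_compContinuousLinearMap_le _ _).trans ?_
      rw [Finset.prod_const, Finset.card_univ, Fintype.card_fin, mul_comm]
      gcongr
      exact h i (by simp) _

@[simp]
theorem precompEquiv_apply (A : E ≃L[ℝ] E') (φ : 𝓓((⊤ : Opens E'), V)) (x : E) :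
    precompEquiv A φ x = φ (A x) := rfl

end Continuity

section Remainder

/-- Uniform first-order Taylor estimate for all derivatives of a test function. -/
theorem eventually_remainder_le {Z : Type} [NormedAddCommGroup Z] [NormedSpace ℝ Z] (j : ℕ) :
    ∀ {V : Type} [NormedAddCommGroup V] [NormedSpace ℝ V] (φ : Z → V), ContDiff ℝ ∞ φ →
      HasCompactSupport φ → ∀ ε : ℝ, 0 < ε → ∃ δ > 0, ∀ h : Z, ‖h‖ < δ → ∀ z,
        ‖iteratedFDeriv ℝ j (fun z ↦ φ (z + h) - φ z - fderiv ℝ φ z h) z‖ ≤ ε * ‖h‖ := by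
  induction j with
  | zero =>
    intro V _ _ φ hφ hc ε hε
    have huc : UniformContinuous (fderiv ℝ φ) :=
      (hc.fderiv ℝ).uniformContinuous_of_continuous (hφ.continuous_fderiv (by simp))
    obtain ⟨δ, hδ, H⟩ := Metric.uniformContinuous_iff.1 huc ε hε
    refine ⟨δ, hδ, fun h hh z ↦ ?_⟩
    rw [norm_iteratedFDeriv_zero]
    have := (convex_ball z δ).norm_image_sub_le_of_norm_fderiv_le' (𝕜 := ℝ) (f := φ)
      (φ := fderiv ℝ φ z) (C := ε) (x := z) (y := z + h)
      (fun x _ ↦ (hφ.differentiable (by simp)).differentiableAt)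
      (fun x hx ↦ by
        rw [← dist_eq_norm]
        exact (H hx).le) (Metric.mem_ball_self hδ) (by simpa using hh)
    simpa using this
  | succ j ih =>
    intro V _ _ φ hφ hc ε hε
    obtain ⟨δ, hδ, H⟩ := ih (fderiv ℝ φ) (hφ.fderiv_right (by simp)) (hc.fderiv ℝ) ε hε
    refine ⟨δ, hδ, fun h hh z ↦ ?_⟩
    rw [← norm_iteratedFDeriv_fderiv]
    convert H h hh z using 3
    ext1 w
    have hd : Differentiable ℝ φ := hφ.differentiable (by simp)
    have hd' : Differentiable ℝ (fderiv ℝ φ) :=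
      (hφ.fderiv_right (m := ∞) (by simp)).differentiable (by simp)
    rw [fderiv_fun_sub, fderiv_fun_sub, fderiv_comp_add_right]
    · congr 1
      ext v
      rw [fderiv_clm_apply hd'.differentiableAt (by fun_prop)]
      simp only [fderiv_fun_const, Pi.zero_apply, ContinuousLinearMap.comp_zero, zero_add]
      exact (hφ.contDiffAt.isSymmSndFDerivAt (by simpa using ENat.LEInfty.out)) v h
    · fun_prop
    · fun_prop
    · fun_prop
    · fun_prop

end Remainder

section PartialEval

variable {E F : Type} [NormedAddCommGroup E] [NormedSpace ℝ E]
  [NormedAddCommGroup F] [NormedSpace ℝ F]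

/-- The section `y ↦ φ (x, y)` of a test function `φ` on `E × F`. -/
noncomputable def slice (φ : 𝓓((⊤ : Opens (E × F)), ℝ)) (x : E) : 𝓓((⊤ : Opens F), ℝ) where
  toFun y := φ (x, y)
  contDiff' := φ.contDiff.comp (contDiff_const.prodMk contDiff_id)
  hasCompactSupport' := HasCompactSupport.intro (φ.hasCompactSupport.image continuous_snd)
    fun y hy ↦ image_eq_zero_of_notMem_tsupport (f := φ) fun h ↦ hy ⟨(x, y), h, rfl⟩
  tsupport_subset' := Set.subset_univ _

@[simp]
theorem slice_apply (φ : 𝓓((⊤ : Opens (E × F)), ℝ)) (x : E) (y : F) :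
    slice φ x y = φ (x, y) := rfl

theorem norm_iteratedFDeriv_slice_le (φ : 𝓓((⊤ : Opens (E × F)), ℝ)) (x : E) (j : ℕ) (y : F) :
    ‖iteratedFDeriv ℝ j (slice φ x) y‖ ≤ ‖iteratedFDeriv ℝ j φ (x, y)‖ := by
  have h1 : (slice φ x : F → ℝ) =
      (fun z ↦ φ (z + (x, 0))) ∘ (ContinuousLinearMap.inr ℝ E F) := by
    ext y; simp
  have hc : ContDiff ℝ ∞ (fun z ↦ φ (z + (x, 0))) := φ.contDiff.comp (by fun_prop)
  rw [h1, ContinuousLinearMap.iteratedFDeriv_comp_right _ hc y (by exact_mod_cast le_top),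
    iteratedFDeriv_comp_add_right]
  refine (ContinuousMultilinearMap.norm_compContinuousLinearMap_le _ _).trans ?_
  have : ((ContinuousLinearMap.inr ℝ E F) y + (x, 0)) = (x, y) := by simp
  rw [this, Finset.prod_const]
  refine mul_le_of_le_one_right (norm_nonneg _) (pow_le_one₀ (norm_nonneg _) ?_)
  exact ContinuousLinearMap.norm_inr_le_one ℝ E F

/-- The function `x ↦ ⟨u, φ (x, ·)⟩`. -/
noncomputable def partialEval (u : 𝓓'((⊤ : Opens F), ℂ)) (φ : 𝓓((⊤ : Opens (E × F)), ℝ)) (x : E) :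
    ℂ := u (slice φ x)

variable (u : 𝓓'((⊤ : Opens F), ℂ))

theorem partialEval_add (φ ψ : 𝓓((⊤ : Opens (E × F)), ℝ)) (x : E) :
    partialEval u (φ + ψ) x = partialEval u φ x + partialEval u ψ x :=
  map_add u (slice φ x) (slice ψ x)

theorem partialEval_sub (φ ψ : 𝓓((⊤ : Opens (E × F)), ℝ)) (x : E) :
    partialEval u (φ - ψ) x = partialEval u φ x - partialEval u ψ x :=
  map_sub u (slice φ x) (slice ψ x)

theorem partialEval_smul (c : ℝ) (φ : 𝓓((⊤ : Opens (E × F)), ℝ)) (x : E) :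
    partialEval u (c • φ) x = c • partialEval u φ x :=
  map_smul u c (slice φ x)

theorem partialEval_eq_zero (φ : 𝓓((⊤ : Opens (E × F)), ℝ)) {x : E}
    (hx : x ∉ Prod.fst '' tsupport φ) : partialEval u φ x = 0 := by
  have : slice φ x = 0 := by
    ext y
    exact image_eq_zero_of_notMem_tsupport (f := φ) fun h ↦ hx ⟨(x, y), h, rfl⟩
  rw [partialEval, this, map_zero]

theorem norm_partialEval_le {K : Set (E × F)} (hK : IsCompact K) :
    ∃ (s : Finset ℕ) (C : ℝ), 0 ≤ C ∧ ∀ φ : 𝓓((⊤ : Opens (E × F)), ℝ), tsupport φ ⊆ K →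
      ∀ B : ℝ, 0 ≤ B → (∀ j ∈ s, ∀ z, ‖iteratedFDeriv ℝ j φ z‖ ≤ B) →
      ∀ x, ‖partialEval u φ x‖ ≤ C * B := by
  let K' : Compacts F := ⟨Prod.snd '' K, hK.image continuous_snd⟩
  let U : 𝓓^{⊤}_{K'}(F, ℝ) →L[ℝ] ℂ :=
    ContinuousLinearMap.comp u (ofSupportedInCLM ℝ (Set.subset_univ _))
  obtain ⟨s, C, _, hC⟩ := Seminorm.bound_of_continuous
    (ContDiffMapSupportedIn.withSeminorms ℝ F ℝ ⊤ K')
    ((normSeminorm ℝ ℂ).comp (U : 𝓓^{⊤}_{K'}(F, ℝ) →ₗ[ℝ] ℂ)) (continuous_norm.comp U.continuous)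
  refine ⟨s, C, C.2, fun φ hφ B hB h x ↦ ?_⟩
  let ψ : 𝓓^{⊤}_{K'}(F, ℝ) := ⟨slice φ x, (slice φ x).contDiff, fun y hy ↦
    image_eq_zero_of_notMem_tsupport (f := φ) fun h ↦ hy ⟨(x, y), hφ h, rfl⟩⟩
  have h1 := hC ψ
  change ‖partialEval u φ x‖ ≤ C * _ at h1
  refine h1.trans (mul_le_mul_of_nonneg_left ?_ C.2)
  refine Seminorm.finset_sup_apply_le hB fun j hj ↦ ?_
  refine (ContDiffMapSupportedIn.seminorm_top_le_iff ℝ hB j ψ).2 fun y _ ↦ ?_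
  exact (norm_iteratedFDeriv_slice_le φ x j y).trans (h j hj _)

/-- The translate `z ↦ φ (z + h)` of a test function. -/
noncomputable def translate {E : Type} [NormedAddCommGroup E] [NormedSpace ℝ E] (h : E)
    (φ : 𝓓((⊤ : Opens E), ℝ)) : 𝓓((⊤ : Opens E), ℝ) where
  toFun z := φ (z + h)
  contDiff' := φ.contDiff.comp (by fun_prop)
  hasCompactSupport' := φ.hasCompactSupport.comp_homeomorph (Homeomorph.addRight h)
  tsupport_subset' := Set.subset_univ _

theorem lineDerivCLM_apply' {E : Type} [NormedAddCommGroup E] [NormedSpace ℝ E] (v : E)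
    (φ : 𝓓((⊤ : Opens E), ℝ)) (z : E) :
    (lineDerivCLM ℝ v φ : 𝓓((⊤ : Opens E), ℝ)) z = fderiv ℝ φ z v := by
  rw [lineDerivCLM_eq_fderivCLM, fderivCLM_apply_of_le φ (by simp)]

theorem tsupport_lineDerivCLM_subset {E : Type} [NormedAddCommGroup E] [NormedSpace ℝ E] (v : E)
    (φ : 𝓓((⊤ : Opens E), ℝ)) :
    tsupport (lineDerivCLM ℝ v φ : 𝓓((⊤ : Opens E), ℝ)) ⊆ tsupport φ := by
  have : ((lineDerivCLM ℝ v φ : 𝓓((⊤ : Opens E), ℝ)) : E → ℝ) = fun z ↦ fderiv ℝ φ z v := by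
    ext z; exact lineDerivCLM_apply' v φ z
  rw [this]
  exact tsupport_fderiv_apply_subset ℝ v

theorem norm_iteratedFDeriv_lineDerivCLM_le {E : Type} [NormedAddCommGroup E] [NormedSpace ℝ E]
    (v : E) (φ : 𝓓((⊤ : Opens E), ℝ)) (j : ℕ) (z : E) :
    ‖iteratedFDeriv ℝ j (lineDerivCLM ℝ v φ : 𝓓((⊤ : Opens E), ℝ)) z‖ ≤
      ‖v‖ * ‖iteratedFDeriv ℝ (j + 1) φ z‖ := by
  have : ((lineDerivCLM ℝ v φ : 𝓓((⊤ : Opens E), ℝ)) : E → ℝ) = fun z ↦ fderiv ℝ φ z v := by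
    ext z; exact lineDerivCLM_apply' v φ z
  rw [this, ← norm_iteratedFDeriv_fderiv]
  exact norm_iteratedFDeriv_clm_apply_const (N := ∞)
    (φ.contDiff.fderiv_right (by simp)).contDiffAt (by exact_mod_cast le_top)

variable [FiniteDimensional ℝ E]

/-- The derivative of `x ↦ ⟨u, φ (x, ·)⟩`, namely `e ↦ ⟨u, ∂_(e,0) φ (x, ·)⟩`. -/
noncomputable def partialEvalDeriv (φ : 𝓓((⊤ : Opens (E × F)), ℝ)) (x : E) : E →L[ℝ] ℂ :=
  LinearMap.toContinuousLinearMap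
    { toFun := fun e ↦ partialEval u (lineDerivCLM ℝ (e, (0 : F)) φ) x
      map_add' := fun e e' ↦ by
        rw [← partialEval_add, ← add_apply, ← lineDerivCLM_add, Prod.mk_add_mk, add_zero]
      map_smul' := fun c e ↦ by
        rw [RingHom.id_apply, ← partialEval_smul, ← smul_apply, ← lineDerivCLM_smul,
          Prod.smul_mk, smul_zero] }

theorem partialEvalDeriv_apply (φ : 𝓓((⊤ : Opens (E × F)), ℝ)) (x e : E) :
    partialEvalDeriv u φ x e = partialEval u (lineDerivCLM ℝ (e, (0 : F)) φ) x := rfl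

theorem hasFDerivAt_partialEval (φ : 𝓓((⊤ : Opens (E × F)), ℝ)) (x : E) :
    HasFDerivAt (partialEval u φ) (partialEvalDeriv u φ x) x := by
  let K : Set (E × F) := (fun p : (E × F) × E ↦ p.1 - (p.2, 0)) ''
    (tsupport φ ×ˢ Metric.closedBall 0 1)
  have hK : IsCompact K := (φ.hasCompactSupport.prod (isCompact_closedBall _ _)).image
    (by fun_prop)
  obtain ⟨s, C, hC, H⟩ := norm_partialEval_le u hK
  rw [hasFDerivAt_iff_isLittleO_nhds_zero, Asymptotics.isLittleO_iff]
  intro c hc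
  have hε : 0 < c / (C + 1) := by positivity
  choose δ hδ hδ' using fun j ↦ eventually_remainder_le (Z := E × F) j φ φ.contDiff
    φ.hasCompactSupport (c / (C + 1)) hε
  have h1 : ∀ᶠ h : E in nhds 0, ∀ j ∈ s, ‖h‖ < δ j :=
    (Finset.eventually_all s).2 fun j _ ↦ by
      filter_upwards [Metric.ball_mem_nhds (0 : E) (hδ j)] with h hh using by simpa using hh
  have h2 : ∀ᶠ h : E in nhds 0, ‖h‖ ≤ 1 := by
    filter_upwards [Metric.closedBall_mem_nhds (0 : E) one_pos] with h hh using by simpa using hh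
  filter_upwards [h1, h2] with h hs hh
  let r : 𝓓((⊤ : Opens (E × F)), ℝ) :=
    translate (h, (0 : F)) φ - φ - lineDerivCLM ℝ (h, (0 : F)) φ
  have hr : (r : E × F → ℝ) =
      fun z ↦ φ (z + (h, 0)) - φ z - fderiv ℝ φ z (h, 0) := by
    ext z
    change φ (z + (h, 0)) - φ z - (lineDerivCLM ℝ (h, (0 : F)) φ : 𝓓((⊤ : Opens (E × F)), ℝ)) z = _
    rw [lineDerivCLM_apply']
  have hrx : partialEval u φ (x + h) - partialEval u φ x - partialEvalDeriv u φ x h =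
      partialEval u r x := by
    rw [partialEval_sub, partialEval_sub, partialEvalDeriv_apply]
    congr 2
    simp only [partialEval]
    congr 1
    ext y
    change φ (x + h, y) = φ ((x, y) + (h, 0))
    simp
  have hsupp : tsupport r ⊆ K := by
    refine closure_minimal (fun z hz ↦ ?_) hK.isClosed
    by_contra hzK
    refine hz ?_
    have hz1 : z ∉ tsupport φ := fun h' ↦ hzK ⟨(z, 0), ⟨h', by simp⟩, by simp⟩
    have hz2 : z + (h, 0) ∉ tsupport φ := fun h' ↦ hzK
      ⟨(z + (h, 0), h), ⟨h', by simpa using hh⟩, by simp⟩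
    have hz3 : fderiv ℝ φ z = 0 := by
      by_contra h'
      exact hz1 (support_fderiv_subset ℝ h')
    rw [hr]
    simp only [image_eq_zero_of_notMem_tsupport hz1, image_eq_zero_of_notMem_tsupport hz2, hz3]
    simp
  rw [hrx]
  have hn : ‖((h, 0) : E × F)‖ = ‖h‖ := by simp [Prod.norm_def]
  refine (H r hsupp (c / (C + 1) * ‖h‖) (by positivity) (fun j hj z ↦ ?_) x).trans ?_
  · rw [hr]
    simpa only [hn] using hδ' j (h, 0) (by rw [hn]; exact hs j hj) z
  · rw [← mul_assoc]
    gcongr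
    rw [mul_div_assoc', div_le_iff₀ (by positivity)]
    nlinarith

theorem fderiv_partialEval (φ : 𝓓((⊤ : Opens (E × F)), ℝ)) (x : E) :
    fderiv ℝ (partialEval u φ) x = partialEvalDeriv u φ x :=
  (hasFDerivAt_partialEval u φ x).fderiv

theorem contDiff_partialEval (φ : 𝓓((⊤ : Opens (E × F)), ℝ)) : ContDiff ℝ ∞ (partialEval u φ) := by
  rw [contDiff_infty]
  intro n
  induction n generalizing φ with
  | zero =>
    exact contDiff_zero.2 (continuous_iff_continuousAt.2 fun x ↦
      (hasFDerivAt_partialEval u φ x).continuousAt)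
  | succ n ih =>
    rw [Nat.cast_succ, contDiff_succ_iff_fderiv_apply]
    refine ⟨fun x ↦ (hasFDerivAt_partialEval u φ x).differentiableAt, by simp, fun e ↦ ?_⟩
    simp only [fderiv_partialEval, partialEvalDeriv_apply]
    exact ih _

theorem norm_iteratedFDeriv_partialEval_le {K : Set (E × F)} (hK : IsCompact K) (i : ℕ) :
    ∃ (s : Finset ℕ) (C : ℝ), 0 ≤ C ∧ ∀ φ : 𝓓((⊤ : Opens (E × F)), ℝ), tsupport φ ⊆ K →
      ∀ B : ℝ, 0 ≤ B → (∀ j ∈ s, ∀ z, ‖iteratedFDeriv ℝ j φ z‖ ≤ B) →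
      ∀ x, ‖iteratedFDeriv ℝ i (partialEval u φ) x‖ ≤ C * B := by
  induction i with
  | zero => simpa only [norm_iteratedFDeriv_zero] using norm_partialEval_le u hK
  | succ i ih =>
    obtain ⟨s, C, hC, H⟩ := ih
    let b := Module.finBasis ℝ E
    let l : Fin (Module.finrank ℝ E) → E →L[ℝ] ℝ :=
      fun k ↦ LinearMap.toContinuousLinearMap (b.coord k)
    let L : Fin (Module.finrank ℝ E) → ℂ →L[ℝ] E →L[ℝ] ℂ :=
      fun k ↦ ContinuousLinearMap.smulRightL ℝ E ℂ (l k)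
    refine ⟨s.image Nat.succ, ∑ k, ‖L k‖ * (C * ‖(b k, (0 : F))‖), by positivity,
      fun φ hφ B hB h x ↦ ?_⟩
    rw [← norm_iteratedFDeriv_fderiv]
    have hf : fderiv ℝ (partialEval u φ) = fun x ↦ ∑ k,
        (L k ∘ partialEval u (lineDerivCLM ℝ (b k, (0 : F)) φ)) x := by
      ext x e
      rw [fderiv_partialEval]
      conv_lhs => rw [← b.sum_repr e, map_sum]
      simp [partialEvalDeriv_apply, L, l, -Module.Basis.sum_repr]
    have hcd : ∀ k, ContDiff ℝ ∞ (L k ∘ partialEval u (lineDerivCLM ℝ (b k, (0 : F)) φ)) :=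
      fun k ↦ (L k).contDiff.comp (contDiff_partialEval u _)
    rw [hf, iteratedFDeriv_fun_sum_apply
      (fun k _ ↦ ((hcd k).of_le (by exact_mod_cast le_top)).contDiffAt), Finset.sum_mul]
    refine (norm_sum_le _ _).trans (Finset.sum_le_sum fun k _ ↦ ?_)
    refine ((L k).norm_iteratedFDeriv_comp_left (N := ∞) (contDiff_partialEval u _).contDiffAt
      (by exact_mod_cast le_top)).trans ?_
    rw [mul_assoc, mul_assoc]
    gcongr
    refine H _ ((tsupport_lineDerivCLM_subset _ φ).trans hφ) _ (by positivity) (fun j hj z ↦ ?_) x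
    refine (norm_iteratedFDeriv_lineDerivCLM_le _ φ j z).trans ?_
    gcongr
    exact h (j + 1) (Finset.mem_image_of_mem _ hj) z

/-- The continuous linear map `φ ↦ (x ↦ ⟨u, φ (x, ·)⟩)` between spaces of test functions. -/
noncomputable def partialEvalCLM :
    𝓓((⊤ : Opens (E × F)), ℝ) →L[ℝ] 𝓓((⊤ : Opens E), ℂ) where
  toFun φ := ⟨partialEval u φ, contDiff_partialEval u φ,
    HasCompactSupport.intro (φ.hasCompactSupport.image continuous_fst)
      fun _ hx ↦ partialEval_eq_zero u φ hx, Set.subset_univ _⟩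
  map_add' φ ψ := TestFunction.ext (partialEval_add u φ ψ)
  map_smul' c φ := TestFunction.ext (partialEval_smul u c φ)
  cont := by
    refine continuous_of_bounds ⟨⟨fun φ ↦ ⟨partialEval u φ, contDiff_partialEval u φ,
      HasCompactSupport.intro (φ.hasCompactSupport.image continuous_fst)
        fun _ hx ↦ partialEval_eq_zero u φ hx, Set.subset_univ _⟩,
      fun φ ψ ↦ TestFunction.ext (partialEval_add u φ ψ)⟩,
      fun c φ ↦ TestFunction.ext (partialEval_smul u c φ)⟩ fun K ↦ ?_
    exact ⟨⟨Prod.fst '' (K : Set (E × F)), K.isCompact.image continuous_fst⟩,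
      fun φ hφ x hx ↦ partialEval_eq_zero u φ fun h ↦ hx (Set.image_mono (f := Prod.fst) hφ h),
      fun i ↦ norm_iteratedFDeriv_partialEval_le u K.isCompact i⟩

@[simp]
theorem partialEvalCLM_apply (φ : 𝓓((⊤ : Opens (E × F)), ℝ)) (x : E) :
    partialEvalCLM u φ x = u (slice φ x) := rfl

end PartialEval

end TestFunction

namespace Distribution

section Operations

variable {E F : Type} [NormedAddCommGroup E] [NormedSpace ℝ E]
  [NormedAddCommGroup F] [NormedSpace ℝ F]

/-- The distribution `φ ↦ ∫ φ g` given by a locally integrable function `g`. -/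
noncomputable def ofFun [MeasureSpace E] [OpensMeasurableSpace E] (g : E → ℂ) :
    𝓓'((⊤ : Opens E), ℂ) :=
  TestFunction.integralAgainstBilinCLM (ContinuousLinearMap.lsmul ℝ ℝ : ℝ →L[ℝ] ℂ →L[ℝ] ℂ)
    volume g

/-- The complex-linear extension of a distribution to complex-valued test functions,
`⟨T, φ⟩ = ⟨T, re φ⟩ + i ⟨T, im φ⟩`. -/
noncomputable def complexify (T : 𝓓'((⊤ : Opens E), ℂ)) : 𝓓((⊤ : Opens E), ℂ) →L[ℝ] ℂ :=
  ContinuousLinearMap.comp T (TestFunction.postcompCLM Complex.reCLM) +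
    Complex.I • ContinuousLinearMap.comp T (TestFunction.postcompCLM Complex.imCLM)

/-- The tensor product `T(x) S(y)` of two distributions, as a distribution on `E × F`:
`⟨T(x) S(y), φ⟩ = ⟨T, x ↦ ⟨S, φ (x, ·)⟩⟩`. -/
noncomputable def tensor [FiniteDimensional ℝ E] (T : 𝓓'((⊤ : Opens E), ℂ))
    (S : 𝓓'((⊤ : Opens F), ℂ)) : 𝓓'((⊤ : Opens (E × F)), ℂ) :=
  ContinuousLinearMap.comp (complexify T) (TestFunction.partialEvalCLM S)

/-- The composition `T ∘ A` of a distribution with a linear automorphism `A`: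
`⟨T ∘ A, φ⟩ = |det A|⁻¹ ⟨T, φ ∘ A⁻¹⟩`. -/
noncomputable def compEquiv (T : 𝓓'((⊤ : Opens E), ℂ)) (A : E ≃L[ℝ] E) : 𝓓'((⊤ : Opens E), ℂ) :=
  |LinearMap.det (A : E →ₗ[ℝ] E)|⁻¹ • ContinuousLinearMap.comp T (TestFunction.precompEquiv A.symm)

end Operations

section Matrices

variable {d : ℕ}

/-- The linear automorphism `(x, y) ↦ (b x + c y, y)` of `ℝᵈ × ℝᵈ`, for an invertible matrix `b`. -/
noncomputable def shear (b c : GL (Fin d) ℝ) :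
    ((Fin d → ℝ) × (Fin d → ℝ)) ≃L[ℝ] ((Fin d → ℝ) × (Fin d → ℝ)) :=
  LinearEquiv.toContinuousLinearEquiv
    { toFun := fun p ↦ (b.val.mulVec p.1 + c.val.mulVec p.2, p.2)
      map_add' := fun p q ↦ by
        ext1
        · simp only [Prod.fst_add, Prod.snd_add, Matrix.mulVec_add]; abel
        · rfl
      map_smul' := fun r p ↦ by
        ext1
        · simp [Matrix.mulVec_smul]
        · rfl
      invFun := fun p ↦ ((b⁻¹).val.mulVec (p.1 - c.val.mulVec p.2), p.2)
      left_inv := fun p ↦ by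
        ext1
        · simp only [add_sub_cancel_right, Matrix.mulVec_mulVec]
          rw [Units.inv_mul, Matrix.one_mulVec]
        · rfl
      right_inv := fun p ↦ by
        ext1
        · simp only [Matrix.mulVec_mulVec]
          rw [Units.mul_inv, Matrix.one_mulVec, sub_add_cancel]
        · rfl }

@[simp]
theorem shear_apply (b c : GL (Fin d) ℝ) (x y : Fin d → ℝ) :
    shear b c (x, y) = (b.val.mulVec x + c.val.mulVec y, y) := rfl

/-- The distribution `f(b x + c y)` on `ℝᵈ × ℝᵈ`: the distribution `f(z)`, regarded as the
distribution `f(z) 1(y)` in the variables `(z, y)`, composed with the linear automorphism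
`(x, y) ↦ (b x + c y, y)`. -/
noncomputable def compSum (f : 𝓓'((⊤ : Opens (Fin d → ℝ)), ℂ)) (b c : GL (Fin d) ℝ) :
    𝓓'((⊤ : Opens ((Fin d → ℝ) × (Fin d → ℝ))), ℂ) :=
  (tensor f (ofFun 1)).compEquiv (shear b c)

end Matrices

end Distribution

/-- Complex exponential polynomials on `ℝᵈ`: finite sums of products of a complex polynomial and
an exponential `x ↦ exp (∑ i, a i * x i)` with `a ∈ ℂᵈ`. -/
def IsExponentialPolynomial {d : ℕ} (g : (Fin d → ℝ) → ℂ) : Prop :=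
  ∃ (r : ℕ) (p : Fin r → MvPolynomial (Fin d) ℂ) (a : Fin r → Fin d → ℂ), ∀ x,
    g x = ∑ j, MvPolynomial.eval (fun i ↦ (x i : ℂ)) (p j) * Complex.exp (∑ i, a j i * (x i : ℂ))

/-! Call a distribution on `ℝᵈ × ℝᵈ` of finite rank if it is a finite sum of tensor products `v(x)
u(y)`. Directional derivatives preserve finite rank, and the derivative along `(p, q)` turns `f(bx +
cy)` into `(∂_{bp+cq} f)(bx + cy)` (`dirDeriv_compSum`). Invertibility of `b_i⁻¹c_i - b_j⁻¹c_j`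
provides, for each `w`, a pair `(p, q)` with `b_j p + c_j q = 0` and `b_i p + c_i q = w`:
differentiating along it kills the `j`-th term and replaces `f_i` by `∂_w f_i`. Once all `j ≠ i` are
removed, `(∂_w^N f_i)(b_i x + c_i y)` has finite rank
(`exists_compSum_dirDeriv_pow_mem_finiteRank`).

If `g(bx + cy) = ∑ v_l(x) u_l(y)` with independent `v_l`, then differentiating in `x` along `b⁻¹w`
or in `y` along `c⁻¹w` gives the same result. Hence the finite-dimensional space of sections `∑
⟨v_l, φ⟩ u_l` is stable under a derivative, and Cayley–Hamilton yields a nonzero `P` with `P(∂_w) g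
= 0` (`exists_aeval_dirDeriv_eq_zero`).

So each `f_i` satisfies a constant-coefficient equation in every coordinate direction. Such
equations are solved on the algebraic dual of complex test functions, where continuity plays no
role, by induction on the coordinates and on the degree of the polynomial
(`isExpPolyFunctional_of_aeval_eq_zero`). The base case is that a functional with all partial
derivatives zero is a multiple of the integral (`exists_eq_mul_integral`). -/

namespace TestFunction

/-! ### Derivatives and products of test functions. -/

section Product

variable {E F V : Type} [NormedAddCommGroup E] [NormedSpace ℝ E]
  [NormedAddCommGroup F] [NormedSpace ℝ F] [NormedAddCommGroup V] [NormedSpace ℝ V]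

theorem lineDerivCLM_apply_eq_fderiv {𝕜 : Type} [NontriviallyNormedField 𝕜] [NormedSpace 𝕜 V]
    [Algebra ℝ 𝕜] [IsScalarTower ℝ 𝕜 V] (v : E) (φ : 𝓓((⊤ : Opens E), V)) (x : E) :
    (lineDerivCLM 𝕜 v φ : 𝓓((⊤ : Opens E), V)) x = fderiv ℝ φ x v := by
  rw [lineDerivCLM_eq_fderivCLM, fderivCLM_apply_of_le φ (by simp)]

/-- The two scalar fields are independent so that derivatives over `ℂ` can be compared with
derivatives over `ℝ` of real and imaginary parts. -/
theorem postcompCLM_lineDerivCLM {V' 𝕜 𝕜' : Type} [NormedAddCommGroup V'] [NormedSpace ℝ V']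
    [NontriviallyNormedField 𝕜] [NormedSpace 𝕜 V] [Algebra ℝ 𝕜] [IsScalarTower ℝ 𝕜 V]
    [NontriviallyNormedField 𝕜'] [NormedSpace 𝕜' V'] [Algebra ℝ 𝕜'] [IsScalarTower ℝ 𝕜' V']
    (L : V →L[ℝ] V') (w : E) (φ : 𝓓((⊤ : Opens E), V)) :
    (postcompCLM L (lineDerivCLM 𝕜 w φ : 𝓓((⊤ : Opens E), V)) : 𝓓((⊤ : Opens E), V')) =
      lineDerivCLM 𝕜' w (postcompCLM L φ) := by
  ext x
  rw [lineDerivCLM_apply_eq_fderiv, postcompCLM_apply, postcompCLM_apply, Function.comp_apply,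
    lineDerivCLM_apply_eq_fderiv, fderiv_comp, L.fderiv]
  · rfl
  · exact L.differentiableAt
  · exact φ.contDiff.differentiable (by simp) _

theorem integrable_of_isFiniteMeasureOnCompacts [MeasurableSpace E] [OpensMeasurableSpace E]
    {μ : Measure E} [IsFiniteMeasureOnCompacts μ] (φ : 𝓓((⊤ : Opens E), V)) : Integrable φ μ :=
  φ.continuous.integrable_of_hasCompactSupport φ.hasCompactSupport

/-- The test function `(x, y) ↦ φ x * ψ y`. -/
noncomputable def prodMul (φ : 𝓓((⊤ : Opens E), ℝ)) (ψ : 𝓓((⊤ : Opens F), ℝ)) :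
    𝓓((⊤ : Opens (E × F)), ℝ) where
  toFun p := φ p.1 * ψ p.2
  contDiff' := (φ.contDiff.comp contDiff_fst).mul (ψ.contDiff.comp contDiff_snd)
  hasCompactSupport' := HasCompactSupport.intro (φ.hasCompactSupport.prod ψ.hasCompactSupport)
    fun p hp ↦ by
      rcases not_and_or.1 hp with h | h
      · rw [image_eq_zero_of_notMem_tsupport h, zero_mul]
      · rw [image_eq_zero_of_notMem_tsupport h, mul_zero]
  tsupport_subset' := Set.subset_univ _

theorem slice_prodMul (φ : 𝓓((⊤ : Opens E), ℝ)) (ψ : 𝓓((⊤ : Opens F), ℝ)) (x : E) :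
    slice (prodMul φ ψ) x = φ x • ψ := rfl

theorem slice_lineDerivCLM_inr (Φ : 𝓓((⊤ : Opens (E × F)), ℝ)) (x : E) (k : F) :
    slice (lineDerivCLM ℝ ((0 : E), k) Φ) x = lineDerivCLM ℝ k (slice Φ x) := by
  ext y
  rw [slice_apply, lineDerivCLM_apply_eq_fderiv, lineDerivCLM_apply_eq_fderiv]
  have h1 : HasFDerivAt Φ (fderiv ℝ Φ (x, y)) (x, y) :=
    (Φ.contDiff.differentiable (by simp) _).hasFDerivAt
  have h2 := h1.comp y (hasFDerivAt_prodMk_right x y)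
  rw [show (slice Φ x : F → ℝ) = Φ ∘ fun y ↦ (x, y) from rfl, h2.fderiv]
  rfl

end Product

end TestFunction

/-! ### Calculus of distributions: complexification, derivatives, tensor products, linear
substitutions. -/

namespace Distribution

open TestFunction

variable {E F : Type} [NormedAddCommGroup E] [NormedSpace ℝ E]
  [NormedAddCommGroup F] [NormedSpace ℝ F]

theorem complexify_apply (T : 𝓓'((⊤ : Opens E), ℂ)) (φ : 𝓓((⊤ : Opens E), ℂ)) :
    complexify T φ = T (postcompCLM Complex.reCLM φ) +
      Complex.I * T (postcompCLM Complex.imCLM φ) := rfl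

theorem complexify_add_left (T T' : 𝓓'((⊤ : Opens E), ℂ)) (φ : 𝓓((⊤ : Opens E), ℂ)) :
    complexify (T + T') φ = complexify T φ + complexify T' φ := by
  rw [complexify_apply, complexify_apply, complexify_apply, add_apply, add_apply]
  ring

theorem complexify_smul_left (c : ℂ) (T : 𝓓'((⊤ : Opens E), ℂ)) (φ : 𝓓((⊤ : Opens E), ℂ)) :
    complexify (c • T) φ = c * complexify T φ := by
  rw [complexify_apply, complexify_apply, smul_apply, smul_apply, smul_eq_mul, smul_eq_mul]
  ring

theorem complexify_smul_right (T : 𝓓'((⊤ : Opens E), ℂ)) (c : ℂ) (φ : 𝓓((⊤ : Opens E), ℂ)) :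
    complexify T (c • φ) = c * complexify T φ := by
  have h1 : (postcompCLM Complex.reCLM (c • φ) : 𝓓((⊤ : Opens E), ℝ)) =
      c.re • postcompCLM Complex.reCLM φ - c.im • postcompCLM Complex.imCLM φ := by
    ext x; exact Complex.mul_re _ _
  have h2 : (postcompCLM Complex.imCLM (c • φ) : 𝓓((⊤ : Opens E), ℝ)) =
      c.re • postcompCLM Complex.imCLM φ + c.im • postcompCLM Complex.reCLM φ := by
    ext x
    refine (Complex.mul_im _ _).trans ?_
    rw [mul_comm c.im]
    simp [postcompCLM_apply, mul_comm]
  rw [complexify_apply, complexify_apply, h1, h2, map_sub, map_add, map_smul, map_smul, map_smul,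
    map_smul]
  simp only [Complex.real_smul]
  conv_rhs => rw [← Complex.re_add_im c]
  linear_combination -(c.im : ℂ) * T (postcompCLM Complex.imCLM φ) * Complex.I_mul_I

theorem complexify_lineDerivCLM (T : 𝓓'((⊤ : Opens E), ℂ)) (w : E) (φ : 𝓓((⊤ : Opens E), ℂ)) :
    complexify (lineDerivCLM w T : 𝓓'((⊤ : Opens E), ℂ)) φ =
      -complexify T (TestFunction.lineDerivCLM ℂ w φ) := by
  rw [complexify_apply, complexify_apply, postcompCLM_lineDerivCLM (𝕜' := ℝ),
    postcompCLM_lineDerivCLM (𝕜' := ℝ), lineDerivCLM_apply, lineDerivCLM_apply]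
  ring

theorem complexify_ofReal (T : 𝓓'((⊤ : Opens E), ℂ)) (φ : 𝓓((⊤ : Opens E), ℝ)) :
    complexify T (postcompCLM Complex.ofRealCLM φ) = T φ := by
  have hre : (postcompCLM Complex.reCLM (postcompCLM Complex.ofRealCLM φ) :
      𝓓((⊤ : Opens E), ℝ)) = φ := by ext x; exact Complex.ofReal_re (φ x)
  have him : (postcompCLM Complex.imCLM (postcompCLM Complex.ofRealCLM φ) :
      𝓓((⊤ : Opens E), ℝ)) = 0 := by ext x; exact Complex.ofReal_im (φ x)
  rw [complexify_apply, hre, him, map_zero, mul_zero, add_zero]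

/-- The derivative of a distribution along a vector, as a complex-linear map. -/
noncomputable def dirDeriv (w : E) : Module.End ℂ 𝓓'((⊤ : Opens E), ℂ) where
  toFun T := lineDerivCLM w T
  map_add' _ _ := map_add _ _ _
  map_smul' c T := by
    ext φ
    exact (mul_neg c (T (TestFunction.lineDerivCLM ℝ w φ))).symm

theorem dirDeriv_apply (w : E) (T : 𝓓'((⊤ : Opens E), ℂ)) (φ : 𝓓((⊤ : Opens E), ℝ)) :
    dirDeriv w T φ = -T (TestFunction.lineDerivCLM ℝ w φ) := rfl

theorem dirDeriv_zero : dirDeriv (0 : E) = 0 := by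
  ext T φ
  have h : (TestFunction.lineDerivCLM ℝ (0 : E) φ : 𝓓((⊤ : Opens E), ℝ)) = 0 := by
    ext x
    rw [lineDerivCLM_apply_eq_fderiv, map_zero]
    rfl
  rw [dirDeriv_apply, h, map_zero, neg_zero]
  rfl

section Tensor

variable [FiniteDimensional ℝ E]

theorem tensor_apply (T : 𝓓'((⊤ : Opens E), ℂ)) (S : 𝓓'((⊤ : Opens F), ℂ))
    (Φ : 𝓓((⊤ : Opens (E × F)), ℝ)) : tensor T S Φ = complexify T (partialEvalCLM S Φ) := rfl

/-- The tensor product of distributions as a complex-bilinear map. -/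
noncomputable def tensorBilin :
    𝓓'((⊤ : Opens E), ℂ) →ₗ[ℂ] 𝓓'((⊤ : Opens F), ℂ) →ₗ[ℂ] 𝓓'((⊤ : Opens (E × F)), ℂ) :=
  LinearMap.mk₂ ℂ tensor
    (fun T T' S ↦ by
      ext Φ
      exact complexify_add_left T T' _)
    (fun c T S ↦ by
      ext Φ
      exact complexify_smul_left c T _)
    (fun T S S' ↦ by
      ext Φ
      change complexify T (partialEvalCLM (S + S') Φ) = complexify T _ + complexify T _
      rw [← map_add]
      rfl)
    (fun c T S ↦ by
      ext Φ
      change complexify T (partialEvalCLM (c • S) Φ) = c * complexify T _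
      rw [← complexify_smul_right]
      rfl)

theorem tensorBilin_apply (T : 𝓓'((⊤ : Opens E), ℂ)) (S : 𝓓'((⊤ : Opens F), ℂ)) :
    tensorBilin T S = tensor T S := rfl

/-- Testing on products turns identities between tensors into scalar identities. Only such test
functions are needed later, so no density of their span enters. -/
theorem tensor_prodMul (T : 𝓓'((⊤ : Opens E), ℂ)) (S : 𝓓'((⊤ : Opens F), ℂ))
    (φ : 𝓓((⊤ : Opens E), ℝ)) (ψ : 𝓓((⊤ : Opens F), ℝ)) :
    tensor T S (prodMul φ ψ) = T φ * S ψ := by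
  have h : partialEvalCLM S (prodMul φ ψ) = S ψ • postcompCLM Complex.ofRealCLM φ := by
    ext x
    rw [partialEvalCLM_apply, slice_prodMul, map_smul S (φ x) ψ]
    exact mul_comm (φ x : ℂ) (S ψ)
  rw [tensor_apply, h, complexify_smul_right, complexify_ofReal, mul_comm]

/-- Split `(h, k)` as `(h, 0) + (0, k)`: the first part differentiates `x ↦ ⟨S, Φ(x, ·)⟩` under the
pairing, the second moves onto `S` with a sign. -/
theorem dirDeriv_tensor (h : E) (k : F) (T : 𝓓'((⊤ : Opens E), ℂ)) (S : 𝓓'((⊤ : Opens F), ℂ)) :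
    dirDeriv (h, k) (tensor T S) = tensor (dirDeriv h T) S + tensor T (dirDeriv k S) := by
  ext Φ
  have h1 : partialEvalCLM S (TestFunction.lineDerivCLM ℝ (h, (0 : F)) Φ) =
      TestFunction.lineDerivCLM ℂ h (partialEvalCLM S Φ) := by
    ext x
    rw [lineDerivCLM_apply_eq_fderiv]
    exact (DFunLike.congr_fun (fderiv_partialEval S Φ x) h).symm
  have h2 : partialEvalCLM S (TestFunction.lineDerivCLM ℝ ((0 : E), k) Φ) =
      -partialEvalCLM (dirDeriv k S) Φ := by
    ext x
    change S (slice _ x) = -dirDeriv k S (slice Φ x)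
    rw [slice_lineDerivCLM_inr, dirDeriv_apply, neg_neg]
  have h3 : (TestFunction.lineDerivCLM ℝ (h, k) Φ : 𝓓((⊤ : Opens (E × F)), ℝ)) =
      TestFunction.lineDerivCLM ℝ (h, (0 : F)) Φ + TestFunction.lineDerivCLM ℝ ((0 : E), k) Φ := by
    rw [← add_apply, ← TestFunction.lineDerivCLM_add, Prod.mk_add_mk, add_zero, zero_add]
  rw [dirDeriv_apply, h3, add_apply, tensor_apply, tensor_apply, map_add, h1, h2, map_add,
    map_neg, neg_add, neg_neg, tensor_apply]
  congr 1
  exact (complexify_lineDerivCLM T h _).symm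

end Tensor

section CompEquiv

theorem compEquiv_apply (T : 𝓓'((⊤ : Opens E), ℂ)) (A : E ≃L[ℝ] E) (φ : 𝓓((⊤ : Opens E), ℝ)) :
    compEquiv T A φ = |LinearMap.det (A : E →ₗ[ℝ] E)|⁻¹ • T (precompEquiv A.symm φ) := rfl

theorem dirDeriv_compEquiv (T : 𝓓'((⊤ : Opens E), ℂ)) (A : E ≃L[ℝ] E) (w : E) :
    dirDeriv w (compEquiv T A) = compEquiv (dirDeriv (A w) T) A := by
  ext φ
  rw [dirDeriv_apply, compEquiv_apply, compEquiv_apply, dirDeriv_apply, smul_neg]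
  congr 3
  ext x
  rw [precompEquiv_apply, lineDerivCLM_apply_eq_fderiv, lineDerivCLM_apply_eq_fderiv,
    show (precompEquiv A.symm φ : E → ℝ) = φ ∘ A.symm from rfl,
    ContinuousLinearEquiv.comp_right_fderiv]
  simp

theorem compEquiv_injective [FiniteDimensional ℝ E] {T : 𝓓'((⊤ : Opens E), ℂ)} {A : E ≃L[ℝ] E}
    (h : compEquiv T A = 0) : T = 0 := by
  ext φ
  have h1 := DFunLike.congr_fun h (precompEquiv A φ)
  have h2 : precompEquiv A.symm (precompEquiv A φ) = φ := by
    ext x; simp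
  rw [compEquiv_apply, h2] at h1
  exact (smul_eq_zero.1 h1).resolve_left
    (inv_ne_zero (abs_ne_zero.2 (LinearEquiv.isUnit_det' A.toLinearEquiv).ne_zero))

end CompEquiv

section Constant

variable [FiniteDimensional ℝ E] [MeasureSpace E] [BorelSpace E]
  [(volume : Measure E).IsAddHaarMeasure]

theorem ofFun_apply {g : E → ℂ} (hg : Continuous g) (φ : 𝓓((⊤ : Opens E), ℝ)) :
    ofFun g φ = ∫ x, φ x * g x := by
  refine (integralAgainstBilinCLM_eq_integral (B := ContinuousLinearMap.lsmul ℝ ℝ)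
    (hg.locallyIntegrable.locallyIntegrableOn _)).trans ?_
  rfl

/-- Integration by parts against the constant function `1`. -/
theorem _root_.TestFunction.integral_lineDerivCLM (w : E) (φ : 𝓓((⊤ : Opens E), ℂ)) :
    ∫ x, (TestFunction.lineDerivCLM ℂ w φ : 𝓓((⊤ : Opens E), ℂ)) x = 0 := by
  have hi := φ.integrable_of_isFiniteMeasureOnCompacts (μ := volume)
  have hi' := (TestFunction.lineDerivCLM ℂ w φ :
    𝓓((⊤ : Opens E), ℂ)).integrable_of_isFiniteMeasureOnCompacts (μ := volume)
  have he := funext fun x ↦ lineDerivCLM_apply_eq_fderiv (𝕜 := ℂ) w φ x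
  rw [he] at hi' ⊢
  have h := integral_bilinear_fderiv_right_eq_neg_left_of_integrable (μ := (volume : Measure E))
    (f := fun _ ↦ (1 : ℝ)) (g := φ) (v := w) (B := ContinuousLinearMap.lsmul ℝ ℝ)
    (by simp) ?_ ?_ (fun _ _ ↦ by fun_prop) fun x _ ↦ φ.contDiff.differentiable (by simp) x
  · simpa using h
  · simpa using hi'
  · simpa using hi

theorem dirDeriv_ofFun_one (w : E) : dirDeriv w (ofFun (1 : E → ℂ)) = 0 := by
  ext φ
  rw [dirDeriv_apply, ofFun_apply continuous_one]
  have h := TestFunction.integral_lineDerivCLM w (postcompCLM Complex.ofRealCLM φ)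
  rw [← postcompCLM_lineDerivCLM (𝕜 := ℝ)] at h
  simp only [Pi.one_apply, mul_one]
  exact neg_eq_zero.2 h

end Constant

end Distribution

/-! ### Polynomials in commuting operators. -/

open Polynomial in
/-- A linear map intertwining two operators intertwines polynomials in them. -/
theorem LinearMap.apply_aeval_of_intertwine {K M N : Type*} [Field K] [AddCommGroup M]
    [Module K M] [AddCommGroup N] [Module K N] {L : M →ₗ[K] N} {D : Module.End K M}
    {D' : Module.End K N} (h : ∀ x, L (D x) = D' (L x)) (P : K[X]) (x : M) :
    L (aeval D P x) = aeval D' P (L x) := by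
  have hpow (n : ℕ) : L ((D ^ n) x) = (D' ^ n) (L x) := by
    induction n with
    | zero => rfl
    | succ n ih => rw [pow_succ', pow_succ', Module.End.mul_apply, h, ih, Module.End.mul_apply]
  induction P using Polynomial.induction_on' with
  | add p q hp hq => simp [hp, hq]
  | monomial n a => simp [aeval_monomial, hpow]

open Polynomial in
/-- A vector of a finite-dimensional invariant subspace is annihilated by a polynomial in the
operator. -/
theorem Module.End.exists_aeval_eq_zero_of_mapsTo {K M : Type*} [Field K] [AddCommGroup M]
    [Module K M] (D : Module.End K M) (U : Submodule K M) [FiniteDimensional K U]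
    (hU : ∀ x ∈ U, D x ∈ U) : ∃ P : K[X], P ≠ 0 ∧ ∀ x ∈ U, aeval D P x = 0 := by
  -- Cayley–Hamilton for the restriction to `U`; the characteristic polynomial is monic, hence
  -- nonzero even if `U = 0`.
  refine ⟨(D.restrict hU).charpoly, (LinearMap.charpoly_monic _).ne_zero, fun x hx ↦ ?_⟩
  have h := LinearMap.apply_aeval_of_intertwine (L := U.subtype) (D := D.restrict hU) (D' := D)
    (fun _ ↦ rfl) (D.restrict hU).charpoly ⟨x, hx⟩
  rw [LinearMap.aeval_self_charpoly] at h
  exact h.symm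

open Polynomial in
-- `X - a` divides `P - P(a)`, and `T - a` kills `x`.
theorem Module.End.aeval_apply_of_apply_eq_smul {K M : Type*} [Field K] [AddCommGroup M]
    [Module K M] {T : Module.End K M} {a : K} {x : M} (h : T x = a • x) (P : K[X]) :
    aeval T P x = P.eval a • x := by
  obtain ⟨Q, hQ⟩ := X_sub_C_dvd_sub_C_eval (a := a) (p := P)
  rw [sub_eq_iff_eq_add] at hQ
  nth_rw 1 [hQ]
  rw [mul_comm, map_add, map_mul, LinearMap.add_apply, Module.End.mul_apply, map_sub, aeval_X,
    aeval_C, aeval_C, LinearMap.sub_apply, h, Module.algebraMap_end_apply, sub_self, map_zero,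
    zero_add, Module.algebraMap_end_apply]

open Polynomial in
theorem Module.End.aeval_aeval_comm {K M : Type*} [Field K] [AddCommGroup M] [Module K M]
    {S T : Module.End K M} (h : Commute S T) (P Q : K[X]) (x : M) :
    aeval S P (aeval T Q x) = aeval T Q (aeval S P x) := by
  refine (LinearMap.apply_aeval_of_intertwine (L := aeval T Q) (fun x ↦ ?_) P x).symm
  exact (LinearMap.apply_aeval_of_intertwine (L := S) (fun x ↦ DFunLike.congr_fun h.eq x) Q x).symm

/-! ### Finite rank and differential equations along a direction. -/

namespace Distribution

open TestFunction Polynomial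

section FiniteRank

variable {E F : Type} [NormedAddCommGroup E] [NormedSpace ℝ E] [FiniteDimensional ℝ E]
  [NormedAddCommGroup F] [NormedSpace ℝ F]

variable (E F) in
/-- The space of finite sums of tensor products of distributions. -/
noncomputable def finiteRank : Submodule ℂ 𝓓'((⊤ : Opens (E × F)), ℂ) :=
  Submodule.span ℂ (Set.range fun p : 𝓓'((⊤ : Opens E), ℂ) × 𝓓'((⊤ : Opens F), ℂ) ↦
    tensor p.1 p.2)

theorem tensor_mem_finiteRank (T : 𝓓'((⊤ : Opens E), ℂ)) (S : 𝓓'((⊤ : Opens F), ℂ)) :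
    tensor T S ∈ finiteRank E F := Submodule.subset_span ⟨(T, S), rfl⟩

theorem dirDeriv_mem_finiteRank (w : E × F) {G : 𝓓'((⊤ : Opens (E × F)), ℂ)}
    (hG : G ∈ finiteRank E F) : dirDeriv w G ∈ finiteRank E F := by
  induction hG using Submodule.span_induction with
  | mem x hx =>
    obtain ⟨⟨T, S⟩, rfl⟩ := hx
    rw [show w = (w.1, w.2) from rfl, dirDeriv_tensor]
    exact add_mem (tensor_mem_finiteRank _ _) (tensor_mem_finiteRank _ _)
  | zero => rw [map_zero]; exact zero_mem _
  | add x y _ _ hx hy => rw [map_add]; exact add_mem hx hy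
  | smul a x _ hx => rw [map_smul]; exact Submodule.smul_mem _ _ hx

/-- A finite sum of tensor products can be written with linearly independent left factors. -/
theorem exists_linearIndependent_of_mem_finiteRank {G : 𝓓'((⊤ : Opens (E × F)), ℂ)}
    (hG : G ∈ finiteRank E F) :
    ∃ (r : ℕ) (v : Fin r → 𝓓'((⊤ : Opens E), ℂ)) (u : Fin r → 𝓓'((⊤ : Opens F), ℂ)),
      LinearIndependent ℂ v ∧ G = ∑ k, tensor (v k) (u k) := by
  have h1 : ∃ (n : ℕ) (v : Fin n → 𝓓'((⊤ : Opens E), ℂ)) (u : Fin n → 𝓓'((⊤ : Opens F), ℂ)),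
      G = ∑ k, tensor (v k) (u k) := by
    obtain ⟨n, c, g, rfl⟩ := Submodule.mem_span_set'.1 hG
    choose p hp using fun i ↦ (g i).2
    refine ⟨n, fun i ↦ c i • (p i).1, fun i ↦ (p i).2, Finset.sum_congr rfl fun i _ ↦ ?_⟩
    rw [← tensorBilin_apply, map_smul, LinearMap.smul_apply, tensorBilin_apply, ← hp]
  obtain ⟨n, v, u, rfl⟩ := h1
  let V := Submodule.span ℂ (Set.range v)
  have : FiniteDimensional ℂ V := FiniteDimensional.span_of_finite ℂ (Set.finite_range v)
  let e := Module.finBasis ℂ V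
  let w (k : Fin n) : V := ⟨v k, Submodule.subset_span ⟨k, rfl⟩⟩
  refine ⟨_, fun l ↦ (e l : 𝓓'((⊤ : Opens E), ℂ)), fun l ↦ ∑ k, e.repr (w k) l • u k,
    e.linearIndependent.map' V.subtype (Submodule.ker_subtype V), ?_⟩
  have hv (k : Fin n) : v k = ∑ l, e.repr (w k) l • (e l : 𝓓'((⊤ : Opens E), ℂ)) := by
    conv_lhs => rw [show v k = V.subtype (w k) from rfl, ← e.sum_repr (w k), map_sum]
    rfl
  simp_rw [← tensorBilin_apply, map_sum, map_smul]
  rw [Finset.sum_comm]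
  refine Finset.sum_congr rfl fun k _ ↦ ?_
  conv_lhs => rw [hv k, map_sum, LinearMap.sum_apply]
  simp_rw [map_smul, LinearMap.smul_apply]

end FiniteRank

section CompSum

variable {d : ℕ}

/-- `f ↦ f (b x + c y)` as a complex-linear map. -/
noncomputable def compSumLin (b c : GL (Fin d) ℝ) : 𝓓'((⊤ : Opens (Fin d → ℝ)), ℂ) →ₗ[ℂ]
    𝓓'((⊤ : Opens ((Fin d → ℝ) × (Fin d → ℝ))), ℂ) where
  toFun f := compSum f b c
  map_add' f g := by
    ext Φ
    rw [compSum, ← tensorBilin_apply, map_add, LinearMap.add_apply]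
    rw [compSum, compSum, add_apply, compEquiv_apply, compEquiv_apply, compEquiv_apply, add_apply,
      smul_add]
    rfl
  map_smul' a f := by
    ext Φ
    rw [compSum, ← tensorBilin_apply, map_smul, LinearMap.smul_apply]
    rw [RingHom.id_apply, compSum, smul_apply, compEquiv_apply, compEquiv_apply, smul_apply,
      smul_comm]
    rfl

theorem compSumLin_apply (b c : GL (Fin d) ℝ) (f : 𝓓'((⊤ : Opens (Fin d → ℝ)), ℂ)) :
    compSumLin b c f = compSum f b c := rfl

/-- Chain rule for the shear: it sends `(h, k)` to `(bh + ck, k)`, and the second component falls on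
the constant factor `1(y)`, where it contributes nothing. -/
theorem dirDeriv_compSum (b c : GL (Fin d) ℝ) (f : 𝓓'((⊤ : Opens (Fin d → ℝ)), ℂ))
    (h k : Fin d → ℝ) : dirDeriv (h, k) (compSum f b c) =
      compSum (dirDeriv (b.val.mulVec h + c.val.mulVec k) f) b c := by
  rw [compSum, dirDeriv_compEquiv, shear_apply, dirDeriv_tensor, dirDeriv_ofFun_one,
    ← tensorBilin_apply, ← tensorBilin_apply, map_zero, add_zero]
  rfl

/-- After undoing the shear, test `f ⊗ 1` on `φ ⊗ χ` with `∫ χ ≠ 0`. -/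
theorem eq_zero_of_compSum_eq_zero {b c : GL (Fin d) ℝ} {f : 𝓓'((⊤ : Opens (Fin d → ℝ)), ℂ)}
    (h : compSum f b c = 0) : f = 0 := by
  have h1 := compEquiv_injective h
  obtain ⟨χ, hχ⟩ : ∃ χ : 𝓓((⊤ : Opens (Fin d → ℝ)), ℝ), ofFun (1 : (Fin d → ℝ) → ℂ) χ ≠ 0 := by
    let B : ContDiffBump (0 : Fin d → ℝ) := ⟨1, 2, one_pos, one_lt_two⟩
    refine ⟨⟨B, B.contDiff, B.hasCompactSupport, Set.subset_univ _⟩, ?_⟩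
    rw [ofFun_apply continuous_one]
    simp only [Pi.one_apply, mul_one]
    change ∫ x, (B x : ℂ) ≠ 0
    rw [integral_complex_ofReal]
    exact_mod_cast B.integral_pos.ne'
  ext φ
  have h2 := DFunLike.congr_fun h1 (prodMul φ χ)
  rw [tensor_prodMul] at h2
  exact (mul_eq_zero.1 h2).resolve_right hχ

/-- If `g (b x + c y)` is a finite sum of products `v(x) u(y)`, then `g` satisfies a linear
differential equation with constant coefficients along every direction. -/
theorem exists_aeval_dirDeriv_eq_zero {b c : GL (Fin d) ℝ} {g : 𝓓'((⊤ : Opens (Fin d → ℝ)), ℂ)}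
    (hg : compSum g b c ∈ finiteRank (Fin d → ℝ) (Fin d → ℝ)) (w : Fin d → ℝ) :
    ∃ P : ℂ[X], P ≠ 0 ∧ aeval (dirDeriv w) P g = 0 := by
  obtain ⟨r, v, u, hv, hG⟩ := exists_linearIndependent_of_mem_finiteRank hg
  -- Both `(h, 0)` and `(0, k)` are mapped to `w` by `(x, y) ↦ bx + cy`, so an `x`-derivative and a
  -- `y`-derivative of `g(bx + cy)` coincide.
  let h := (b⁻¹).val.mulVec w
  let k := (c⁻¹).val.mulVec w
  have hh : b.val.mulVec h = w := by
    rw [Matrix.mulVec_mulVec, Units.mul_inv, Matrix.one_mulVec]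
  have hk : c.val.mulVec k = w := by
    rw [Matrix.mulVec_mulVec, Units.mul_inv, Matrix.one_mulVec]
  have hD1 (f : 𝓓'((⊤ : Opens (Fin d → ℝ)), ℂ)) :
      dirDeriv (h, 0) (compSum f b c) = compSum (dirDeriv w f) b c := by
    rw [dirDeriv_compSum, hh, Matrix.mulVec_zero, add_zero]
  have hD2 (f : 𝓓'((⊤ : Opens (Fin d → ℝ)), ℂ)) :
      dirDeriv (0, k) (compSum f b c) = compSum (dirDeriv w f) b c := by
    rw [dirDeriv_compSum, hk, Matrix.mulVec_zero, zero_add]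
  have hE1 (T S : 𝓓'((⊤ : Opens (Fin d → ℝ)), ℂ)) :
      dirDeriv (h, (0 : Fin d → ℝ)) (tensor T S) = tensor (dirDeriv h T) S := by
    rw [dirDeriv_tensor, dirDeriv_zero, LinearMap.zero_apply, ← tensorBilin_apply _ 0, map_zero,
      add_zero]
  have hE2 (T S : 𝓓'((⊤ : Opens (Fin d → ℝ)), ℂ)) :
      dirDeriv ((0 : Fin d → ℝ), k) (tensor T S) = tensor T (dirDeriv k S) := by
    rw [dirDeriv_tensor, dirDeriv_zero, LinearMap.zero_apply, ← tensorBilin_apply 0, map_zero,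
      LinearMap.zero_apply, zero_add]
  -- The sections of `g(bx + cy)`: its pairings with `φ` in the variable `x`.
  let U : Submodule ℂ 𝓓'((⊤ : Opens (Fin d → ℝ)), ℂ) :=
    Submodule.span ℂ (Set.range fun φ : 𝓓((⊤ : Opens (Fin d → ℝ)), ℝ) ↦ ∑ l, v l φ • u l)
  have hUfin : FiniteDimensional ℂ U := by
    have := FiniteDimensional.span_of_finite ℂ (Set.finite_range u)
    refine Submodule.finiteDimensional_of_le (S₂ := Submodule.span ℂ (Set.range u))
      (Submodule.span_le.2 ?_)
    rintro _ ⟨φ, rfl⟩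
    exact Submodule.sum_mem _ fun l _ ↦ Submodule.smul_mem _ _ (Submodule.subset_span ⟨l, rfl⟩)
  have hUinv : ∀ x ∈ U, dirDeriv k x ∈ U := by
    intro x hx
    induction hx using Submodule.span_induction with
    | mem x hx =>
      obtain ⟨φ, rfl⟩ := hx
      -- The `y`-derivative of a section equals the section of the `x`-derivative, which is the
      -- section at `-∂_h φ`.
      have : dirDeriv k (∑ l, v l φ • u l) =
          ∑ l, v l (-TestFunction.lineDerivCLM ℝ h φ : 𝓓((⊤ : Opens (Fin d → ℝ)), ℝ)) • u l := by
        ext ψ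
        have h1 := (hD2 g).trans (hD1 g).symm
        rw [hG, map_sum, map_sum] at h1
        simp_rw [hE1, hE2] at h1
        have h2 := DFunLike.congr_fun h1 (prodMul φ ψ)
        simpa [tensor_prodMul, dirDeriv_apply] using h2
      simp only [this]
      exact Submodule.subset_span ⟨_, rfl⟩
    | zero => rw [map_zero]; exact zero_mem _
    | add x y _ _ hx hy => rw [map_add]; exact add_mem hx hy
    | smul a x _ hx => rw [map_smul]; exact Submodule.smul_mem _ _ hx
  obtain ⟨P, hP, hPU⟩ := (dirDeriv k).exists_aeval_eq_zero_of_mapsTo U hUinv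
  refine ⟨P, hP, eq_zero_of_compSum_eq_zero (b := b) (c := c) ?_⟩
  -- `P(∂_k)` kills `∑ ⟨v_l, φ⟩ u_l` for every `φ`; independence of the `v_l` then gives `P(∂_k) u_l
  -- = 0` for each `l`.
  have hPu (l : Fin r) : aeval (dirDeriv k) P (u l) = 0 := by
    ext ψ
    refine linearIndependent_iff'.1 hv Finset.univ
      (fun l ↦ aeval (dirDeriv k) P (u l) ψ) ?_ l (Finset.mem_univ l)
    ext φ
    have h1 := DFunLike.congr_fun (hPU _ (Submodule.subset_span ⟨φ, rfl⟩)) ψ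
    simpa [mul_comm] using h1
  rw [← compSumLin_apply, LinearMap.apply_aeval_of_intertwine (D' := dirDeriv (0, k))
    (fun f ↦ (hD2 f).symm), compSumLin_apply, hG, map_sum]
  refine Finset.sum_eq_zero fun l _ ↦ ?_
  rw [← tensorBilin_apply, ← LinearMap.apply_aeval_of_intertwine (D := dirDeriv k)
    (fun S ↦ (hE2 _ S).symm), hPu, map_zero]

end CompSum

end Distribution

/-! ### Functionals with vanishing partial derivatives are multiples of the integral. -/

namespace TestFunction

section LineIntegral

variable {E : Type} [NormedAddCommGroup E] [NormedSpace ℝ E]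

theorem integral_sub_smul_sub_smul (g : E → ℂ) (x w : E) (s : ℝ) :
    ∫ t : ℝ, g (x - s • w - t • w) = ∫ t : ℝ, g (x - t • w) := by
  rw [← integral_add_left_eq_self (fun t : ℝ ↦ g (x - t • w)) s]
  simp_rw [add_smul, sub_sub]

theorem hasCompactSupport_comp_sub_smul (φ : 𝓓((⊤ : Opens E), ℂ)) (x : E) {w : E} (hw : w ≠ 0) :
    HasCompactSupport fun t : ℝ ↦ φ (x - t • w) :=
  φ.hasCompactSupport.comp_isClosedEmbedding
    ((Homeomorph.subLeft x).isClosedEmbedding.comp (isClosedEmbedding_smul_left hw))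

theorem integrable_comp_sub_smul (φ : 𝓓((⊤ : Opens E), ℂ)) (x : E) {w : E} (hw : w ≠ 0) :
    Integrable fun t : ℝ ↦ φ (x - t • w) :=
  (φ.continuous.comp (by fun_prop)).integrable_of_hasCompactSupport
    (hasCompactSupport_comp_sub_smul φ x hw)

variable [MeasurableSpace E] [BorelSpace E]

/-- Integration along the line `ℝw` is convolution with the image measure on that line, so
smoothness follows from that of convolutions. -/
theorem convolution_map_smul_eq (φ : 𝓓((⊤ : Opens E), ℂ)) (w : E) (ν : Measure ℝ) (x : E) :
    convolution (fun _ ↦ (1 : ℝ)) φ (ContinuousLinearMap.lsmul ℝ ℝ)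
      (Measure.map (fun t : ℝ ↦ t • w) ν) x = ∫ t, φ (x - t • w) ∂ν := by
  rw [convolution_def, integral_map]
  · simp
  · exact Continuous.aemeasurable (by fun_prop)
  · exact Continuous.aestronglyMeasurable
      (by
      simp only [ContinuousLinearMap.lsmul_apply, one_smul]
      exact φ.continuous.comp (by fun_prop))

variable [FiniteDimensional ℝ E]

theorem locallyIntegrable_one_map_smul {w : E} (hw : w ≠ 0) (ν : Measure ℝ)
    [IsLocallyFiniteMeasure ν] :
    LocallyIntegrable (fun _ ↦ (1 : ℝ)) (Measure.map (fun t : ℝ ↦ t • w) ν) := by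
  have hcl : Topology.IsClosedEmbedding fun t : ℝ ↦ t • w := isClosedEmbedding_smul_left hw
  have : IsFiniteMeasureOnCompacts (Measure.map (fun t : ℝ ↦ t • w) ν) := ⟨fun K hK ↦ by
    rw [Measure.map_apply hcl.continuous.measurable hK.measurableSet]
    exact (hcl.isCompact_preimage hK).measure_lt_top⟩
  have := isLocallyFiniteMeasure_of_isFiniteMeasureOnCompacts
    (μ := Measure.map (fun t : ℝ ↦ t • w) ν)
  exact locallyIntegrable_const 1

theorem contDiff_integral_sub_smul (φ : 𝓓((⊤ : Opens E), ℂ)) {w : E} (hw : w ≠ 0)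
    (ν : Measure ℝ) [IsLocallyFiniteMeasure ν] :
    ContDiff ℝ ∞ fun x ↦ ∫ t, φ (x - t • w) ∂ν := by
  simp_rw [← convolution_map_smul_eq]
  exact φ.hasCompactSupport.contDiff_convolution_right _
    (locallyIntegrable_one_map_smul hw ν) φ.contDiff

theorem fderiv_integral_Ioi_sub_smul (φ : 𝓓((⊤ : Opens E), ℂ)) {w : E} (hw : w ≠ 0) (x : E) :
    fderiv ℝ (fun x ↦ ∫ t in Set.Ioi (0 : ℝ), φ (x - t • w)) x w = φ x := by
  let g (t : ℝ) : ℂ := φ (x - t • w)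
  have hg : Continuous g := φ.continuous.comp (by fun_prop)
  have hgi : Integrable g := integrable_comp_sub_smul φ x hw
  have h1 : HasFDerivAt (fun x ↦ ∫ t in Set.Ioi (0 : ℝ), φ (x - t • w))
      (fderiv ℝ (fun x ↦ ∫ t in Set.Ioi (0 : ℝ), φ (x - t • w)) x) (x - (0 : ℝ) • w) := by
    rw [zero_smul, sub_zero]
    exact ((contDiff_integral_sub_smul φ hw _).differentiable (by simp) x).hasFDerivAt
  have h2 : HasDerivAt (fun t : ℝ ↦ x - t • w) (-w) 0 := by
    simpa using ((hasDerivAt_id (0 : ℝ)).smul_const w).const_sub x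
  have h3 := h1.comp_hasDerivAt (0 : ℝ) h2
  -- Moving `x` by `-s w` shifts the lower limit of integration from `0` to `s`, so the fundamental
  -- theorem of calculus applies in `s`.
  have h4 (s : ℝ) : ∫ t in Set.Ioi (0 : ℝ), φ (x - s • w - t • w) =
      (∫ t in s..0, g t) + ∫ t in Set.Ioi (0 : ℝ), g t := by
    rw [← intervalIntegral.integral_Ioi_sub_Ioi' hgi.integrableOn hgi.integrableOn, sub_add_cancel,
      ← (measurePreserving_add_left volume s).setIntegral_preimage_emb
        (measurableEmbedding_addLeft s) g (Set.Ioi s)]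
    simp [g, add_smul, sub_sub]
  have h5 : HasDerivAt (fun s : ℝ ↦ ∫ t in Set.Ioi (0 : ℝ), φ (x - s • w - t • w)) (-g 0) 0 := by
    simp_rw [h4]
    exact (intervalIntegral.integral_hasDerivAt_left (hg.intervalIntegrable _ _)
      hg.stronglyMeasurable.stronglyMeasurableAtFilter hg.continuousAt).add_const _
  have h6 := h3.unique h5
  rw [map_neg, neg_inj] at h6
  simpa [g] using h6

end LineIntegral

section Coordinates

variable {d : ℕ}

local notation "X" => 𝓓((⊤ : Opens (Fin d → ℝ)), ℂ)

theorem exists_apply_eq_zero_of_lt (φ : X) : ∃ R : ℝ, 0 ≤ R ∧ ∀ x i, R < |x i| → φ x = 0 := by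
  obtain ⟨R, hR⟩ := φ.hasCompactSupport.isBounded.subset_closedBall 0
  refine ⟨max R 0, le_max_right _ _, fun x i hx ↦ image_eq_zero_of_notMem_tsupport fun h ↦ ?_⟩
  have h1 : ‖x‖ ≤ R := by simpa using hR h
  have h2 : |x i| ≤ ‖x‖ := norm_le_pi_norm x i
  exact absurd ((le_max_left R 0).trans_lt hx) (not_lt.2 (h2.trans h1))

theorem hasCompactSupport_of_forall_lt {g : (Fin d → ℝ) → ℂ} {R : ℝ} (hR : 0 ≤ R)
    (h : ∀ x i, R < |x i| → g x = 0) : HasCompactSupport g :=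
  HasCompactSupport.intro (isCompact_closedBall (0 : Fin d → ℝ) R) fun x hx ↦ by
    rw [mem_closedBall_zero_iff, pi_norm_le_iff_of_nonneg hR, not_forall] at hx
    obtain ⟨i, hi⟩ := hx
    exact h x i (not_le.1 hi)

/-- A test function whose integrals over all lines parallel to a coordinate axis vanish is a
partial derivative of a test function. -/
theorem exists_lineDerivCLM_eq (φ : X) (j : Fin d)
    (hφ : ∀ x, ∫ t : ℝ, φ (x - t • Pi.single j (1 : ℝ)) = 0) :
    ∃ Φ : X, lineDerivCLM ℂ (Pi.single j (1 : ℝ)) Φ = φ := by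
  have hw : (Pi.single j (1 : ℝ) : Fin d → ℝ) ≠ 0 := by simp
  obtain ⟨R, hR, h0⟩ := exists_apply_eq_zero_of_lt φ
  refine ⟨⟨fun x ↦ ∫ t in Set.Ioi (0 : ℝ), φ (x - t • Pi.single j (1 : ℝ)),
    contDiff_integral_sub_smul φ hw _, hasCompactSupport_of_forall_lt hR fun x i hx ↦ ?_,
    Set.subset_univ _⟩, ?_⟩
  · by_cases hij : i = j
    · subst hij
      -- The ray `x - t e_i`, `t > 0`, misses the support when `x_i < -R`. When `x_i > R` it is the
      -- opposite ray that misses it, and the vanishing of the full line integral is used.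
      rcases lt_abs.1 hx with hx | hx
      · have h1 := integral_add_compl (measurableSet_Ioi (a := (0 : ℝ)))
          (integrable_comp_sub_smul φ x hw)
        rw [hφ] at h1
        rw [← h1, left_eq_add]
        refine setIntegral_eq_zero_of_forall_eq_zero fun t ht ↦ h0 _ i ?_
        simp only [Set.compl_Ioi, Set.mem_Iic] at ht
        simp only [Pi.sub_apply, Pi.smul_apply, Pi.single_eq_same, smul_eq_mul, mul_one]
        exact lt_abs.2 (.inl (by linarith))
      · refine setIntegral_eq_zero_of_forall_eq_zero fun t ht ↦ h0 _ i ?_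
        simp only [Set.mem_Ioi] at ht
        simp only [Pi.sub_apply, Pi.smul_apply, Pi.single_eq_same, smul_eq_mul, mul_one]
        exact lt_abs.2 (.inr (by linarith))
    · refine setIntegral_eq_zero_of_forall_eq_zero fun t _ ↦ h0 _ i ?_
      simpa [hij] using hx
  · ext x
    rw [lineDerivCLM_apply_eq_fderiv]
    exact fderiv_integral_Ioi_sub_smul φ hw x

variable (ψ : ContDiffBump (0 : ℝ))

/-- Modulo partial derivatives of test functions, a test function can be replaced by a product of
a bump function in one variable and a function not depending on this variable. -/
theorem exists_eq_add_lineDerivCLM (φ : X) (j : Fin d) :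
    ∃ φ' Φ : X, φ = φ' + lineDerivCLM ℂ (Pi.single j (1 : ℝ)) Φ ∧ ∀ x,
      φ' x = ψ.normed volume (x j) * ∫ t : ℝ, φ (x - t • Pi.single j (1 : ℝ)) := by
  have hw : (Pi.single j (1 : ℝ) : Fin d → ℝ) ≠ 0 := by simp
  obtain ⟨R, hR, h0⟩ := exists_apply_eq_zero_of_lt φ
  let φ' : X := ⟨fun x ↦ ψ.normed volume (x j) * ∫ t : ℝ, φ (x - t • Pi.single j (1 : ℝ)),
    (Complex.ofRealCLM.contDiff.comp (ψ.contDiff_normed.comp (contDiff_apply ℝ ℝ j))).mul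
      (contDiff_integral_sub_smul φ hw _),
    hasCompactSupport_of_forall_lt (le_max_of_le_left hR : 0 ≤ max R ψ.rOut) fun x i hx ↦ by
      by_cases hij : i = j
      · subst hij
        have : x i ∉ Function.support (ψ.normed volume) := by
          rw [ψ.support_normed_eq, mem_ball_zero_iff, not_lt]
          exact ((le_max_right _ _).trans_lt hx).le
        rw [Function.notMem_support.1 this, Complex.ofReal_zero, zero_mul]
      · rw [integral_eq_zero_of_ae (.of_forall fun t ↦ h0 _ i ?_), mul_zero]
        simpa [hij] using (le_max_left _ _).trans_lt hx,
    Set.subset_univ _⟩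
  have hφ' (x) : φ' x = ψ.normed volume (x j) * ∫ t : ℝ, φ (x - t • Pi.single j (1 : ℝ)) := rfl
  -- The normalized bump has integral `1`, so `φ` and `φ'` have equal integrals over all lines in
  -- direction `j`.
  obtain ⟨Φ, hΦ⟩ := exists_lineDerivCLM_eq (φ - φ') j fun x ↦ by
    simp_rw [sub_apply]
    rw [integral_sub (integrable_comp_sub_smul φ x hw) (integrable_comp_sub_smul φ' x hw)]
    have h1 (t : ℝ) : φ' (x - t • Pi.single j (1 : ℝ)) =
        ψ.normed volume (x j - t) * ∫ t : ℝ, φ (x - t • Pi.single j (1 : ℝ)) := by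
      rw [hφ']
      congr 1
      · simp
      · exact integral_sub_smul_sub_smul φ x _ t
    simp_rw [h1]
    rw [integral_mul_const, integral_sub_left_eq_self (fun t ↦ (ψ.normed volume t : ℂ)),
      integral_complex_ofReal, ψ.integral_normed, Complex.ofReal_one, one_mul, sub_self]
  exact ⟨φ', Φ, by rw [hΦ, add_sub_cancel], hφ'⟩

/-- The one-variable replacement is applied to the coordinates in `s` one after another. Each step
changes the function by a partial derivative, which `f` does not see, and integrating `k` over a new
coordinate keeps it independent of the earlier ones. -/
theorem exists_eq_prod_mul (s : Finset (Fin d)) (φ : X) :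
    ∃ (φ' : X) (k : (Fin d → ℝ) → ℂ), (∀ x, φ' x = (∏ i ∈ s, (ψ.normed volume (x i) : ℂ)) * k x) ∧
      (∀ i ∈ s, ∀ x (t : ℝ), k (x - t • Pi.single i (1 : ℝ)) = k x) ∧
      ∀ f : X →ₗ[ℂ] ℂ, (∀ j (Φ : X), f (lineDerivCLM ℂ (Pi.single j (1 : ℝ)) Φ) = 0) → f φ = f φ' := by
  induction s using Finset.induction_on with
  | empty => exact ⟨φ, φ, by simp, by simp, fun _ _ ↦ rfl⟩
  | insert j s hj ih =>
    obtain ⟨φ₁, k, hφ₁, hk, hf⟩ := ih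
    obtain ⟨φ', Φ, h, hφ'⟩ := exists_eq_add_lineDerivCLM ψ φ₁ j
    refine ⟨φ', fun x ↦ ∫ t : ℝ, k (x - t • Pi.single j (1 : ℝ)), fun x ↦ ?_, fun i hi x t ↦ ?_,
      fun f hf' ↦ ?_⟩
    · rw [hφ', Finset.prod_insert hj, mul_assoc]
      congr 1
      rw [← integral_const_mul]
      congr 1 with t
      rw [hφ₁]
      congr 1
      refine Finset.prod_congr rfl fun i hi ↦ ?_
      have hij : i ≠ j := fun h ↦ hj (h ▸ hi)
      simp [hij]
    · rcases Finset.mem_insert.1 hi with rfl | hi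
      · exact integral_sub_smul_sub_smul k x _ t
      · refine integral_congr_ae (.of_forall fun r ↦ ?_)
        beta_reduce
        rw [sub_right_comm, hk i hi]
    · rw [hf f hf', h, map_add, hf', add_zero]

/-- A linear functional on test functions that vanishes on all partial derivatives is a multiple of
the integral. -/
theorem exists_eq_mul_integral (f : X →ₗ[ℂ] ℂ)
    (hf : ∀ j (Φ : X), f (lineDerivCLM ℂ (Pi.single j (1 : ℝ)) Φ) = 0) :
    ∃ c : ℂ, ∀ φ, f φ = c * ∫ x, φ x := by
  let ψ : ContDiffBump (0 : ℝ) := ⟨1, 2, one_pos, one_lt_two⟩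
  let Ψ : X := ⟨fun x ↦ ∏ i, (ψ.normed volume (x i) : ℂ),
    contDiff_prod fun i _ ↦ Complex.ofRealCLM.contDiff.comp
      (ψ.contDiff_normed.comp (contDiff_apply ℝ ℝ i)),
    hasCompactSupport_of_forall_lt ψ.rOut_pos.le fun x i hx ↦ by
      refine Finset.prod_eq_zero (Finset.mem_univ i) ?_
      have : x i ∉ Function.support (ψ.normed volume) := by
        rw [ψ.support_normed_eq, mem_ball_zero_iff, not_lt]
        exact hx.le
      rw [Function.notMem_support.1 this, Complex.ofReal_zero],
    Set.subset_univ _⟩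
  have hΨ : ∫ x, Ψ x = 1 := by
    change ∫ x : Fin d → ℝ, ∏ i, (ψ.normed volume (x i) : ℂ) = 1
    rw [integral_fintype_prod_volume_eq_prod (f := fun _ t ↦ (ψ.normed volume t : ℂ))]
    simp_rw [integral_complex_ofReal, ψ.integral_normed]
    simp
  let I : X →ₗ[ℂ] ℂ :=
    { toFun := fun φ ↦ ∫ x, φ x
      map_add' := fun φ φ' ↦ integral_add φ.integrable_of_isFiniteMeasureOnCompacts
        φ'.integrable_of_isFiniteMeasureOnCompacts
      map_smul' := fun c φ ↦ integral_const_mul c _ }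
  have hI : ∀ j (Φ : X), I (lineDerivCLM ℂ (Pi.single j (1 : ℝ)) Φ) = 0 :=
    fun j Φ ↦ integral_lineDerivCLM _ Φ
  refine ⟨f Ψ, fun φ ↦ ?_⟩
  -- With all coordinates treated, `k` is constant and `φ'` is the multiple `k 0` of `Ψ`.
  obtain ⟨φ', k, hφ', hk, h⟩ := exists_eq_prod_mul ψ Finset.univ φ
  have hk0 (x : Fin d → ℝ) : k x = k 0 := by
    have (s : Finset (Fin d)) : k (x - ∑ i ∈ s, x i • Pi.single i (1 : ℝ)) = k x := by
      induction s using Finset.induction_on with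
      | empty => simp
      | insert j s hj ih =>
        rw [Finset.sum_insert hj, add_comm, ← sub_sub, hk j (Finset.mem_univ j), ih]
    rw [← this Finset.univ]
    congr 1
    ext i
    simp [Pi.single_apply]
  have he : φ' = k 0 • Ψ := by
    ext x
    rw [hφ', hk0]
    exact mul_comm _ _
  -- The integral also vanishes on partial derivatives, so the same reduction applied to it
  -- identifies `k 0` as `∫ φ`.
  have h1 := h I hI
  rw [he, map_smul, smul_eq_mul, show I Ψ = 1 from hΨ, mul_one] at h1
  rw [h f hf, he, map_smul, show ∫ x, φ x = I φ from rfl, h1, smul_eq_mul, mul_comm]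

end Coordinates

end TestFunction

/-! ### Closure properties of exponential polynomials. -/

section ExponentialPolynomial

variable {d : ℕ}

theorem IsExponentialPolynomial.continuous {g : (Fin d → ℝ) → ℂ} (hg : IsExponentialPolynomial g) :
    Continuous g := by
  obtain ⟨r, p, a, h⟩ := hg
  rw [funext h]
  refine continuous_finsetSum _ fun j _ ↦ .mul ?_ (by fun_prop)
  exact (p j).continuous_eval.comp (by fun_prop)

theorem IsExponentialPolynomial.add {g g' : (Fin d → ℝ) → ℂ} (hg : IsExponentialPolynomial g)
    (hg' : IsExponentialPolynomial g') : IsExponentialPolynomial (g + g') := by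
  obtain ⟨r, p, a, h⟩ := hg
  obtain ⟨r', p', a', h'⟩ := hg'
  refine ⟨r + r', Fin.append p p', Fin.append a a', fun x ↦ ?_⟩
  simp [Fin.sum_univ_add, h, h']

theorem IsExponentialPolynomial.mul_term {g : (Fin d → ℝ) → ℂ} (hg : IsExponentialPolynomial g)
    (p : MvPolynomial (Fin d) ℂ) (a : Fin d → ℂ) : IsExponentialPolynomial fun x ↦
      (MvPolynomial.eval (fun i ↦ (x i : ℂ)) p * Complex.exp (∑ i, a i * (x i : ℂ))) * g x := by
  obtain ⟨r, q, b, h⟩ := hg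
  refine ⟨r, fun j ↦ p * q j, fun j ↦ a + b j, fun x ↦ ?_⟩
  simp only [h, Finset.mul_sum, map_mul, Pi.add_apply, add_mul, Finset.sum_add_distrib,
    Complex.exp_add]
  exact Finset.sum_congr rfl fun j _ ↦ by ring

theorem IsExponentialPolynomial.const (c : ℂ) :
    IsExponentialPolynomial fun _ : Fin d → ℝ ↦ c :=
  ⟨1, fun _ ↦ MvPolynomial.C c, fun _ ↦ 0, fun x ↦ by simp⟩

theorem IsExponentialPolynomial.zero : IsExponentialPolynomial (0 : (Fin d → ℝ) → ℂ) :=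
  .const 0

end ExponentialPolynomial

/-! ### Constant-coefficient equations on the algebraic dual of test functions. -/

namespace TestFunction

open Polynomial

section Dual

variable {E : Type} [NormedAddCommGroup E] [NormedSpace ℝ E]

/-- Multiplication of linear functionals on test functions by a smooth function. -/
noncomputable def mulDual (m : E → ℂ) (hm : ContDiff ℝ ∞ m) :
    Module.End ℂ (Module.Dual ℂ 𝓓((⊤ : Opens E), ℂ)) :=
  LinearMap.dualMap
    { toFun := fun φ ↦ ⟨fun x ↦ m x * φ x, hm.mul φ.contDiff, φ.hasCompactSupport.mul_left,
        Set.subset_univ _⟩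
      map_add' := fun φ ψ ↦ TestFunction.ext fun x ↦ mul_add (m x) (φ x) (ψ x)
      map_smul' := fun c φ ↦ TestFunction.ext fun x ↦ mul_left_comm (m x) c (φ x) }

/-- The derivative of linear functionals on test functions along a vector. -/
noncomputable def derivDual (w : E) : Module.End ℂ (Module.Dual ℂ 𝓓((⊤ : Opens E), ℂ)) :=
  -LinearMap.dualMap (lineDerivCLM ℂ w : 𝓓((⊤ : Opens E), ℂ) →L[ℂ] 𝓓((⊤ : Opens E), ℂ)).toLinearMap

theorem derivDual_apply (w : E) (f : Module.Dual ℂ 𝓓((⊤ : Opens E), ℂ))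
    (φ : 𝓓((⊤ : Opens E), ℂ)) : derivDual w f φ = -f (lineDerivCLM ℂ w φ) := rfl

theorem mulDual_apply_eq (m : E → ℂ) (hm : ContDiff ℝ ∞ m)
    (f : Module.Dual ℂ 𝓓((⊤ : Opens E), ℂ)) {φ ψ : 𝓓((⊤ : Opens E), ℂ)}
    (h : ∀ x, ψ x = m x * φ x) : mulDual m hm f φ = f ψ :=
  congrArg f (TestFunction.ext fun x ↦ (h x).symm)

theorem mulDual_mulDual {m₁ m₂ : E → ℂ} (h₁ : ContDiff ℝ ∞ m₁) (h₂ : ContDiff ℝ ∞ m₂)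
    (h : ∀ x, m₁ x * m₂ x = 1) (f : Module.Dual ℂ 𝓓((⊤ : Opens E), ℂ)) :
    mulDual m₁ h₁ (mulDual m₂ h₂ f) = f := by
  ext φ
  refine congrArg f (TestFunction.ext fun x ↦ ?_)
  change m₂ x * (m₁ x * φ x) = φ x
  rw [← mul_assoc, mul_comm (m₂ x), h, one_mul]

/-- The transpose of the Leibniz rule `m ∂φ = ∂(mφ) - m'φ`. -/
theorem derivDual_mulDual (w : E) {m m' : E → ℂ} (hm : ContDiff ℝ ∞ m) (hm' : ContDiff ℝ ∞ m')
    (h : ∀ x, fderiv ℝ m x w = m' x) (f : Module.Dual ℂ 𝓓((⊤ : Opens E), ℂ)) :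
    derivDual w (mulDual m hm f) = mulDual m hm (derivDual w f) + mulDual m' hm' f := by
  ext φ
  let ψ : 𝓓((⊤ : Opens E), ℂ) :=
    ⟨fun x ↦ m x * φ x, hm.mul φ.contDiff, φ.hasCompactSupport.mul_left, Set.subset_univ _⟩
  let ψ' : 𝓓((⊤ : Opens E), ℂ) :=
    ⟨fun x ↦ m' x * φ x, hm'.mul φ.contDiff, φ.hasCompactSupport.mul_left, Set.subset_univ _⟩
  rw [LinearMap.add_apply, derivDual_apply, mulDual_apply_eq m hm (derivDual w f) (ψ := ψ)
    fun _ ↦ rfl, mulDual_apply_eq m' hm' f (ψ := ψ') fun _ ↦ rfl, derivDual_apply,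
    mulDual_apply_eq m hm f (ψ := lineDerivCLM ℂ w ψ - ψ') fun x ↦ ?_, map_sub]
  · ring
  · rw [sub_apply, lineDerivCLM_apply_eq_fderiv, lineDerivCLM_apply_eq_fderiv]
    change fderiv ℝ (fun x ↦ m x * φ x) x w - m' x * φ x = _
    rw [fderiv_fun_mul (hm.differentiable (by simp) x) (φ.contDiff.differentiable (by simp) x)]
    simp [h, mul_comm]

theorem commute_derivDual (v w : E) : Commute (derivDual v) (derivDual w) := by
  ext f φ
  rw [Module.End.mul_apply, Module.End.mul_apply, derivDual_apply, derivDual_apply,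
    derivDual_apply, derivDual_apply]
  congr 3
  ext x
  have hd : Differentiable ℝ (fderiv ℝ φ) :=
    (φ.contDiff.fderiv_right (m := ∞) (by simp)).differentiable (by simp)
  have h2 (v w : E) : (lineDerivCLM ℂ v (lineDerivCLM ℂ w φ : 𝓓((⊤ : Opens E), ℂ)) :
      𝓓((⊤ : Opens E), ℂ)) x = fderiv ℝ (fderiv ℝ φ) x v w := by
    rw [lineDerivCLM_apply_eq_fderiv, funext fun x ↦ lineDerivCLM_apply_eq_fderiv (𝕜 := ℂ) w φ x,
      fderiv_clm_apply hd.differentiableAt (by fun_prop)]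
    simp
  rw [h2, h2]
  exact (φ.contDiff.contDiffAt.isSymmSndFDerivAt (by simpa using ENat.LEInfty.out)) _ _

end Dual

section ConstantCoefficients

variable {d : ℕ}

local notation "Y" => Module.Dual ℂ 𝓓((⊤ : Opens (Fin d → ℝ)), ℂ)
local notation "D" j:max => derivDual (Pi.single j (1 : ℝ) : Fin d → ℝ)

/-- The linear functional is integration against an exponential polynomial. -/
def IsExpPolyFunctional (f : Module.Dual ℂ 𝓓((⊤ : Opens (Fin d → ℝ)), ℂ)) : Prop :=
  ∃ g : (Fin d → ℝ) → ℂ, IsExponentialPolynomial g ∧ ∀ φ, f φ = ∫ x, φ x * g x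

theorem integrable_mul_continuous (φ : 𝓓((⊤ : Opens (Fin d → ℝ)), ℂ)) {g : (Fin d → ℝ) → ℂ}
    (hg : Continuous g) : Integrable fun x ↦ φ x * g x :=
  (φ.continuous.mul hg).integrable_of_hasCompactSupport φ.hasCompactSupport.mul_right

theorem IsExpPolyFunctional.add {f f' : Y} (hf : IsExpPolyFunctional f)
    (hf' : IsExpPolyFunctional f') : IsExpPolyFunctional (f + f') := by
  obtain ⟨g, hg, h⟩ := hf
  obtain ⟨g', hg', h'⟩ := hf'
  refine ⟨g + g', hg.add hg', fun φ ↦ ?_⟩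
  rw [LinearMap.add_apply, h, h', ← integral_add (integrable_mul_continuous φ hg.continuous)
    (integrable_mul_continuous φ hg'.continuous)]
  simp_rw [Pi.add_apply, mul_add]

/-- The function `x ↦ c * x_j ^ k * exp (a * x_j)`. -/
noncomputable def expMonomial (j : Fin d) (c : ℂ) (k : ℕ) (a : ℂ) (x : Fin d → ℝ) : ℂ :=
  c * (x j : ℂ) ^ k * Complex.exp (a * x j)

theorem contDiff_expMonomial (j : Fin d) (c : ℂ) (k : ℕ) (a : ℂ) :
    ContDiff ℝ ∞ (expMonomial j c k a) := by
  have h : ContDiff ℝ ∞ fun x : Fin d → ℝ ↦ (x j : ℂ) :=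
    Complex.ofRealCLM.contDiff.comp (contDiff_apply ℝ ℝ j)
  exact (contDiff_const.mul (h.pow k)).mul (contDiff_const.mul h).cexp

/-- At `k = 0` the truncated exponent `k - 1` is harmless because of the factor `k`. -/
theorem fderiv_expMonomial (j : Fin d) (c : ℂ) (k : ℕ) (a : ℂ) (x w : Fin d → ℝ) :
    fderiv ℝ (expMonomial j c k a) x w =
      w j * (c * (k * (x j : ℂ) ^ (k - 1)) * Complex.exp (a * x j) + a * expMonomial j c k a x) := by
  have h : HasFDerivAt (fun x : Fin d → ℝ ↦ (x j : ℂ)) (Complex.ofRealCLM.comp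
      (ContinuousLinearMap.proj (R := ℝ) (φ := fun _ : Fin d ↦ ℝ) j)) x :=
    (Complex.ofRealCLM.comp
      (ContinuousLinearMap.proj (R := ℝ) (φ := fun _ : Fin d ↦ ℝ) j)).hasFDerivAt
  have h1 : HasFDerivAt (expMonomial j c k a) _ x :=
    ((h.pow k).const_mul c).mul (h.const_mul a).cexp
  rw [h1.fderiv]
  simp [expMonomial]
  ring

/-- Multiplication of linear functionals by `x ↦ c * x_j ^ k * exp (a * x_j)`. -/
noncomputable def expMul (j : Fin d) (c : ℂ) (k : ℕ) (a : ℂ) : Module.End ℂ Y :=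
  mulDual (expMonomial j c k a) (contDiff_expMonomial j c k a)

theorem expMul_expMul_neg (j : Fin d) (a : ℂ) (f : Y) :
    expMul j 1 0 a (expMul j 1 0 (-a) f) = f :=
  mulDual_mulDual _ _ (fun x ↦ by simp [expMonomial, ← Complex.exp_add]) f

theorem IsExpPolyFunctional.expMul {f : Y} (hf : IsExpPolyFunctional f) (j : Fin d) (c : ℂ) (k : ℕ)
    (a : ℂ) : IsExpPolyFunctional (expMul j c k a f) := by
  obtain ⟨g, hg, h⟩ := hf
  refine ⟨_, hg.mul_term (MvPolynomial.C c * MvPolynomial.X j ^ k) (Pi.single j a), fun φ ↦ ?_⟩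
  refine (h _).trans (integral_congr_ae (.of_forall fun x ↦ ?_))
  change expMonomial j c k a x * φ x * g x = _
  simp only [expMonomial, map_mul, map_pow, MvPolynomial.eval_C, MvPolynomial.eval_X,
    Pi.single_apply, ite_mul, zero_mul, Finset.sum_ite_eq', Finset.mem_univ, if_true]
  ring

theorem derivDual_expMul_of_ne {i j : Fin d} (h : i ≠ j) (c : ℂ) (k : ℕ) (a : ℂ) (f : Y) :
    (D i) (expMul j c k a f) = expMul j c k a ((D i) f) := by
  rw [expMul, derivDual_mulDual _ _ (contDiff_const (c := (0 : ℂ)))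
    (fun x ↦ by simp [fderiv_expMonomial, h.symm])]
  refine add_eq_left.2 (LinearMap.ext fun φ ↦ ?_)
  rw [mulDual_apply_eq (ψ := 0) _ _ _ fun x ↦ (zero_mul _).symm, map_zero]
  rfl

theorem aeval_derivDual_expMul_of_ne {i j : Fin d} (h : i ≠ j) (c : ℂ) (k : ℕ) (a : ℂ) (P : ℂ[X])
    (f : Y) : aeval (D i) P (expMul j c k a f) = expMul j c k a (aeval (D i) P f) :=
  (LinearMap.apply_aeval_of_intertwine (fun f ↦ (derivDual_expMul_of_ne h c k a f).symm) P f).symm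

/-- The integrating factor `exp(-a x_j)` cancels the eigenvalue `a`. -/
theorem derivDual_expMul_exp (j : Fin d) (a : ℂ) {f : Y} (hf : (D j) f = a • f) :
    (D j) (expMul j 1 0 (-a) f) = 0 := by
  rw [expMul, derivDual_mulDual _ _ (contDiff_const.mul (contDiff_expMonomial j 1 0 (-a)))
    (m' := fun x ↦ -a * expMonomial j 1 0 (-a) x) (fun x ↦ by simp [fderiv_expMonomial]), hf]
  ext φ
  rw [LinearMap.add_apply, mulDual_apply_eq _ _ f (ψ := -a • ⟨fun x ↦ expMonomial j 1 0 (-a) x * φ x,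
    (contDiff_expMonomial j 1 0 (-a)).mul φ.contDiff, φ.hasCompactSupport.mul_left,
    Set.subset_univ _⟩) fun x ↦ (mul_assoc _ _ _).symm, map_smul, map_smul, neg_smul]
  exact add_neg_cancel _

theorem derivDual_expMul_succ (j : Fin d) (c : ℂ) (k : ℕ) (f : Y) :
    (D j) (expMul j c (k + 1) 0 f) =
      expMul j c (k + 1) 0 ((D j) f) + expMul j ((k + 1) * c) k 0 f :=
  derivDual_mulDual _ _ _ (fun x ↦ by
    simp [fderiv_expMonomial]
    simp [expMonomial]
    ring) f

/-- On an eigenvector, each application of `D_j - a` only differentiates the power of `x_j`, so `k`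
applications leave `k!`. The coefficient `c` is arbitrary so that the induction can absorb the
factors produced. -/
theorem aeval_X_sub_C_pow_expMul (j : Fin d) (a : ℂ) {f : Y} (hf : (D j) f = a • f) (k : ℕ) :
    ∀ c : ℂ, aeval (D j) ((X - C a) ^ k) (expMul j c k 0 f) = (c * k.factorial) • f := by
  induction k with
  | zero =>
    intro c
    rw [pow_zero, map_one, Module.End.one_apply]
    ext φ
    refine (mulDual_apply_eq _ _ f (ψ := c • φ) fun x ↦ by simp [expMonomial]).trans ?_
    simp
  | succ k ih =>
    intro c
    have h : aeval (D j) (X - C a) (expMul j c (k + 1) 0 f) = expMul j ((k + 1) * c) k 0 f := by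
      rw [map_sub, aeval_X, aeval_C, LinearMap.sub_apply, derivDual_expMul_succ, hf, map_smul,
        Module.algebraMap_end_apply, add_sub_cancel_left]
    rw [pow_succ, map_mul, Module.End.mul_apply, h, ih, Nat.factorial_succ]
    congr 1
    push_cast
    ring

/-- Solves `Q(D_j) y = h` in the possibly resonant case. Write `Q = (X - a)^k R` with `R(a) ≠ 0`:
the first factor maps `x_j^k h` to `k! h`, on which `R(D_j)` acts as `R(a)`, so the coefficient is
`1 / (R(a) k!)`. -/
theorem exists_aeval_derivDual_expMul_eq (j : Fin d) {a : ℂ} {h : Y} (hh : (D j) h = a • h)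
    {Q : ℂ[X]} (hQ : Q ≠ 0) : ∃ (c : ℂ) (k : ℕ), aeval (D j) Q (expMul j c k 0 h) = h := by
  obtain ⟨R, hR, hRa⟩ := exists_eq_pow_rootMultiplicity_mul_and_not_dvd Q hQ a
  set k := Q.rootMultiplicity a
  have hRa : R.eval a ≠ 0 := fun h ↦ hRa (dvd_iff_isRoot.2 h)
  refine ⟨(R.eval a * k.factorial)⁻¹, k, ?_⟩
  rw [hR, mul_comm, map_mul, Module.End.mul_apply, aeval_X_sub_C_pow_expMul j a hh, map_smul,
    Module.End.aeval_apply_of_apply_eq_smul hh, smul_smul]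
  have : (k.factorial : ℂ) ≠ 0 := by exact_mod_cast k.factorial_ne_zero
  convert! one_smul ℂ h
  field_simp

/-- Induction on the degree of `P = (X - a) Q`. The functional `h = Q(D_j) f` is an eigenvector of
`D_j`, handled by `ih` after removing the exponential; subtracting a particular solution of `Q(D_j)
y = h` from `f` leaves a functional annihilated by `Q(D_j)`. -/
theorem isExpPolyFunctional_of_aeval_insert {t : Finset (Fin d)} (j : Fin d)
    (ih : ∀ f : Y, (∀ i, ∃ P : ℂ[X], P ≠ 0 ∧ aeval (D i) P f = 0) → (∀ i ∉ t, (D i) f = 0) →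
      IsExpPolyFunctional f) (n : ℕ) :
    ∀ (P : ℂ[X]) (f : Y), P ≠ 0 → P.natDegree = n → aeval (D j) P f = 0 →
      (∀ i, ∃ P : ℂ[X], P ≠ 0 ∧ aeval (D i) P f = 0) →
      (∀ i ∉ insert j t, (D i) f = 0) → IsExpPolyFunctional f := by
  induction n with
  | zero =>
    intro P f hP hn hPf _ _
    rw [eq_C_of_natDegree_eq_zero hn] at hP hPf
    rw [aeval_C, Module.algebraMap_end_apply] at hPf
    rw [(smul_eq_zero.1 hPf).resolve_left fun h ↦ hP (by rw [h, C_0])]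
    exact ⟨0, .zero, by simp⟩
  | succ n ihn =>
    intro P f hP hn hPf hA ht
    obtain ⟨a, ha⟩ := IsAlgClosed.exists_root P fun h ↦ by
      rw [natDegree_eq_zero_iff_degree_le_zero.2 h.le] at hn
      exact absurd hn (by simp)
    obtain ⟨Q, rfl⟩ := dvd_iff_isRoot.2 ha
    have hQ : Q ≠ 0 := right_ne_zero_of_mul hP
    have hQn : Q.natDegree = n := by
      rw [natDegree_mul (X_sub_C_ne_zero a) hQ, natDegree_X_sub_C] at hn
      lia
    let h : Y := aeval (D j) Q f
    have hcomm (i : Fin d) (P P' : ℂ[X]) :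
        aeval (D i) P (aeval (D j) P' f) = aeval (D j) P' (aeval (D i) P f) :=
      Module.End.aeval_aeval_comm (commute_derivDual _ _) P P' f
    have hh : (D j) h = a • h := by
      rw [map_mul, Module.End.mul_apply, map_sub, aeval_X, aeval_C, LinearMap.sub_apply,
        Module.algebraMap_end_apply] at hPf
      exact sub_eq_zero.1 hPf
    have hh0 : IsExpPolyFunctional h := by
      -- `exp(-a x_j) h` has zero derivative in direction `j`, so only the coordinates in `t` remain
      -- active and `ih` applies.
      rw [← expMul_expMul_neg j a h]
      have h0 := derivDual_expMul_exp j a hh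
      refine (ih _ (fun i ↦ ?_) fun i hi ↦ ?_).expMul j 1 0 a
      · by_cases hij : i = j
        · subst hij
          exact ⟨X, X_ne_zero, by rw [aeval_X, h0]⟩
        · obtain ⟨P, hP, hPi⟩ := hA i
          exact ⟨P, hP, by rw [aeval_derivDual_expMul_of_ne hij, hcomm, hPi, map_zero, map_zero]⟩
      · by_cases hij : i = j
        · subst hij
          exact h0
        · have h1 := hcomm i X Q
          rw [aeval_X, ht i (by simp [hij, hi]), map_zero] at h1
          rw [derivDual_expMul_of_ne hij, h1, map_zero]
    obtain ⟨c, k, hck⟩ := exists_aeval_derivDual_expMul_eq j hh hQ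
    have hQf : aeval (D j) Q (f - expMul j c k 0 h) = 0 := by rw [map_sub, hck, sub_self]
    rw [← sub_add_cancel f (expMul j c k 0 h)]
    refine (ihn Q _ hQ hQn hQf (fun i ↦ ?_) fun i hi ↦ ?_).add (hh0.expMul j c k 0)
    · by_cases hij : i = j
      · subst hij
        exact ⟨Q, hQ, hQf⟩
      · obtain ⟨P, hP, hPi⟩ := hA i
        refine ⟨P, hP, ?_⟩
        rw [map_sub, aeval_derivDual_expMul_of_ne hij, hcomm, hPi, map_zero, map_zero, sub_zero]
    · have hij : i ≠ j := fun h ↦ hi (h ▸ Finset.mem_insert_self _ _)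
      have h1 := hcomm i X Q
      rw [aeval_X, ht i hi, map_zero] at h1
      rw [map_sub, derivDual_expMul_of_ne hij, h1, ht i hi, map_zero, sub_zero]

/-- A linear functional on test functions that satisfies a linear differential equation with
constant coefficients in every coordinate direction is an exponential polynomial. -/
theorem isExpPolyFunctional_of_aeval_eq_zero (f : Y)
    (hf : ∀ i, ∃ P : ℂ[X], P ≠ 0 ∧ aeval (D i) P f = 0) : IsExpPolyFunctional f := by
  -- `t` contains every coordinate along which the derivative of `f` may be nonzero; the induction
  -- ends with a functional all of whose partial derivatives vanish.
  have (t : Finset (Fin d)) : ∀ f : Y, (∀ i, ∃ P : ℂ[X], P ≠ 0 ∧ aeval (D i) P f = 0) →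
      (∀ i ∉ t, (D i) f = 0) → IsExpPolyFunctional f := by
    induction t using Finset.induction_on with
    | empty =>
      intro f _ h0
      obtain ⟨c, hc⟩ := exists_eq_mul_integral f fun j Φ ↦
        neg_eq_zero.1 (DFunLike.congr_fun (h0 j (Finset.notMem_empty j)) Φ)
      refine ⟨fun _ ↦ c, .const c, fun φ ↦ ?_⟩
      rw [hc, integral_mul_const, mul_comm]
    | insert j t _ ih =>
      intro f hf h0
      obtain ⟨P, hP, hPf⟩ := hf j
      exact isExpPolyFunctional_of_aeval_insert j ih _ P f hP rfl hPf hf h0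
  exact this Finset.univ f hf fun i hi ↦ absurd (Finset.mem_univ i) hi

end ConstantCoefficients

end TestFunction

/-! ### Return to distributions, and elimination of terms. -/

namespace Distribution

open TestFunction Polynomial

section Complexify

variable {E : Type} [NormedAddCommGroup E] [NormedSpace ℝ E]

/-- The extension of distributions to complex-valued test functions, as a complex-linear map. -/
noncomputable def complexifyDual :
    𝓓'((⊤ : Opens E), ℂ) →ₗ[ℂ] Module.Dual ℂ 𝓓((⊤ : Opens E), ℂ) where
  toFun T :=
    { toFun := complexify T
      map_add' := map_add (complexify T)
      map_smul' := complexify_smul_right T }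
  map_add' T T' := LinearMap.ext fun φ ↦ complexify_add_left T T' φ
  map_smul' c T := LinearMap.ext fun φ ↦ complexify_smul_left c T φ

theorem complexifyDual_dirDeriv (w : E) (T : 𝓓'((⊤ : Opens E), ℂ)) :
    complexifyDual (dirDeriv w T) = derivDual w (complexifyDual T) :=
  LinearMap.ext fun φ ↦ complexify_lineDerivCLM T w φ

end Complexify

variable {d : ℕ}

/-- A distribution satisfying a linear differential equation with constant coefficients in every
coordinate direction is an exponential polynomial. -/
theorem exists_eq_ofFun_of_aeval_eq_zero (f : 𝓓'((⊤ : Opens (Fin d → ℝ)), ℂ))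
    (hf : ∀ i, ∃ P : ℂ[X], P ≠ 0 ∧ aeval (dirDeriv (Pi.single i (1 : ℝ))) P f = 0) :
    ∃ g : (Fin d → ℝ) → ℂ, Continuous g ∧ IsExponentialPolynomial g ∧ f = ofFun g := by
  obtain ⟨g, hg, h⟩ := isExpPolyFunctional_of_aeval_eq_zero (complexifyDual f) fun i ↦ by
    obtain ⟨P, hP, hPf⟩ := hf i
    refine ⟨P, hP, ?_⟩
    rw [← LinearMap.apply_aeval_of_intertwine (complexifyDual_dirDeriv _), hPf, map_zero]
  refine ⟨g, hg.continuous, hg, ?_⟩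
  ext φ
  rw [ofFun_apply hg.continuous, ← complexify_ofReal]
  exact h _

variable {m : ℕ} {b c : Fin m → GL (Fin d) ℝ}

/-- If the characteristic directions of two terms differ, there is a direction along which the
second argument is constant and the first one varies in a prescribed direction. -/
theorem exists_mulVec_add_mulVec_eq {b c b' c' : GL (Fin d) ℝ}
    (h : IsUnit ((b⁻¹ * c).val - (b'⁻¹ * c').val : Matrix (Fin d) (Fin d) ℝ)) (w : Fin d → ℝ) :
    ∃ p q : Fin d → ℝ, b.val.mulVec p + c.val.mulVec q = w ∧
      b'.val.mulVec p + c'.val.mulVec q = 0 := by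
  obtain ⟨A, hA⟩ := h
  -- The second equation forces `p = -b'⁻¹c'q`; the first then reads `b (b⁻¹c - b'⁻¹c') q = w`.
  let q := (A⁻¹).val.mulVec ((b⁻¹).val.mulVec w)
  have hq : (b⁻¹).val.mulVec (c.val.mulVec q) - (b'⁻¹).val.mulVec (c'.val.mulVec q) =
      (b⁻¹).val.mulVec w := by
    have h1 : A.val.mulVec q = (b⁻¹).val.mulVec w := by
      rw [Matrix.mulVec_mulVec, Units.mul_inv, Matrix.one_mulVec]
    rw [hA, Matrix.sub_mulVec] at h1
    simpa only [Matrix.mulVec_mulVec, Units.val_mul] using h1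
  have hb (b : GL (Fin d) ℝ) (x : Fin d → ℝ) : b.val.mulVec ((b⁻¹).val.mulVec x) = x := by
    rw [Matrix.mulVec_mulVec, Units.mul_inv, Matrix.one_mulVec]
  refine ⟨-(b'⁻¹).val.mulVec (c'.val.mulVec q), q, ?_, ?_⟩
  · have h2 := congrArg b.val.mulVec hq
    rwa [Matrix.mulVec_sub, hb, hb, sub_eq_neg_add, ← Matrix.mulVec_neg] at h2
  · rw [Matrix.mulVec_neg, hb, neg_add_cancel]

/-- Differentiating along suitable directions eliminates all terms but one. -/
theorem exists_compSum_dirDeriv_pow_mem_finiteRank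
    (hbc : ∀ i j, i ≠ j → IsUnit
      (((b i)⁻¹ * c i).val - ((b j)⁻¹ * c j).val : Matrix (Fin d) (Fin d) ℝ))
    {f : Fin m → 𝓓'((⊤ : Opens (Fin d → ℝ)), ℂ)}
    (hf : ∑ i, compSum (f i) (b i) (c i) ∈ finiteRank (Fin d → ℝ) (Fin d → ℝ))
    (i : Fin m) (w : Fin d → ℝ) :
    ∃ N : ℕ, compSum ((dirDeriv w ^ N) (f i)) (b i) (c i) ∈
      finiteRank (Fin d → ℝ) (Fin d → ℝ) := by
  -- `s` is the set of terms already eliminated; each elimination costs one derivative `∂_w` of `f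
  -- i`.
  have (s : Finset (Fin m)) (hs : i ∉ s) : ∃ (N : ℕ) (f' : Fin m → 𝓓'((⊤ : Opens (Fin d → ℝ)), ℂ)),
      f' i = (dirDeriv w ^ N) (f i) ∧ (∀ j ∈ s, f' j = 0) ∧
      ∑ i, compSum (f' i) (b i) (c i) ∈ finiteRank (Fin d → ℝ) (Fin d → ℝ) := by
    induction s using Finset.induction_on with
    | empty => exact ⟨0, f, rfl, by simp, hf⟩
    | insert j s _ ih =>
      rw [Finset.mem_insert, not_or] at hs
      obtain ⟨N, f', hi, hj, hmem⟩ := ih hs.2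
      obtain ⟨p, q, hp, hq⟩ := exists_mulVec_add_mulVec_eq (hbc i j hs.1) w
      -- Differentiation of the whole sum along `(p, q)` differentiates `f' i` along `w` and `f' j`
      -- along `0`; terms that already vanish stay zero.
      refine ⟨N + 1, fun l ↦ dirDeriv ((b l).val.mulVec p + (c l).val.mulVec q) (f' l), ?_,
        fun l hl ↦ ?_, ?_⟩
      · beta_reduce
        rw [hp, hi, pow_succ', Module.End.mul_apply]
      · beta_reduce
        rcases Finset.mem_insert.1 hl with rfl | hl
        · rw [hq, dirDeriv_zero, LinearMap.zero_apply]
        · rw [hj l hl, map_zero]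
      · have h := dirDeriv_mem_finiteRank (p, q) hmem
        rw [map_sum] at h
        simpa only [dirDeriv_compSum] using h
  obtain ⟨N, f', hi, hj, hmem⟩ := this (Finset.univ.erase i) (Finset.notMem_erase _ _)
  refine ⟨N, ?_⟩
  rwa [Finset.sum_eq_single i, hi] at hmem
  · intro l _ hl
    rw [hj l (Finset.mem_erase.2 ⟨hl, Finset.mem_univ l⟩), ← compSumLin_apply, map_zero]
  · exact fun h ↦ absurd (Finset.mem_univ i) h

end Distribution

theorem mainTheorem7 (d m n : ℕ)
    (f : Fin m → 𝓓'((⊤ : Opens (Fin d → ℝ)), ℂ))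
    (u v : Fin n → 𝓓'((⊤ : Opens (Fin d → ℝ)), ℂ))
    (b c : Fin m → GL (Fin d) ℝ)
    (hbc : ∀ i j, i ≠ j → IsUnit
      (((b i)⁻¹ * c i).val - ((b j)⁻¹ * c j).val : Matrix (Fin d) (Fin d) ℝ))
    (heq : ∑ i, Distribution.compSum (f i) (b i) (c i) =
      ∑ k, Distribution.tensor (v k) (u k)) :
    ∀ i, ∃ g : (Fin d → ℝ) → ℂ, Continuous g ∧ IsExponentialPolynomial g ∧
      f i = Distribution.ofFun g := by
  intro i
  refine Distribution.exists_eq_ofFun_of_aeval_eq_zero (f i) fun j ↦ ?_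
  obtain ⟨N, hN⟩ := Distribution.exists_compSum_dirDeriv_pow_mem_finiteRank hbc
    (heq ▸ Submodule.sum_mem _ fun k _ ↦ Distribution.tensor_mem_finiteRank (v k) (u k)) i
    (Pi.single j 1)
  obtain ⟨P, hP, h⟩ := Distribution.exists_aeval_dirDeriv_eq_zero hN (Pi.single j 1)
  -- `P` annihilates `∂_j^N f_i`, not `f_i` itself, hence the factor `X ^ N`.
  refine ⟨P * Polynomial.X ^ N, mul_ne_zero hP (pow_ne_zero _ Polynomial.X_ne_zero), ?_⟩
  rwa [map_mul, map_pow, Polynomial.aeval_X, Module.End.mul_apply]
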